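/- \textbf{Setting.} Let $\Lambda\subset\mathbb{R}^k$ be compact, let $\mu$ be a Borel probability measure on $\Lambda$, and let $\mathcal N\in\mathbb N$. For every $\lambda\in\Lambda$ let $\mathbb I_\lambda=\{f_\lambda^1,\dots,f_\lambda^{\mathcal N(\lambda)}\}$, with $0\le\mathcal N(\lambda)\le\mathcal N$, be a finite family of similarities $f_\lambda^i:\mathbb{R}^d\to\mathbb{R}^d$, $\|f_\lambda^i(x)-f_\lambda^i(y)\|=c_\lambda^i\|x-y\|$, where $\mathcal N(\lambda)$ and $c_\lambda^i$ depend measurably on $\lambda$. Assume that $\mathbb I_\lambda=\varnothing$ if and only if $\lambda=0$, and that $0$, if it lies in $\Lambda$, is an isolated point of $\Lambda$. The pair $(\mathbb L,\mu)$ with $\mathbb L=\{\mathbb I_\lambda\}_{\lambda\in\Lambda}$ is called a random iterated function system (RIFS). It - is \emph{non-extinguishing} if $\int_\Lambda\mathcal N(\lambda)\,d\mu(\lambda)>1$; - satisfies the \emph{contraction condition} if there are $0<c_{\min}\le c_{\max}<1$ with $c_{\min}\le c_\lambda^i\le c_{\max}$ for all $\lambda\in\Lambda\setminus\{0\}$ and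 $1\le i\le\mathcal N(\lambda)$; - satisfies the \emph{uniform open set condition (UOSC)} if there is a non-empty open set $\mathcal O\subseteq\mathbb{R}^d$ such that, for every $\lambda\in\Lambda\setminus\{0\}$, the sets $f_\lambda^i(\mathcal O)$, $1\le i\le\mathcal N(\lambda)$, are contained in $\mathcal O$ and pairwise disjoint. Let $\mathfrak T=\bigcup_{n\ge0}\{1,\dots,\mathcal N\}^n$ be the rooted $\mathcal N$-ary tree, with root $()$, and let $\mathcal T=\Lambda^{\mathfrak T}$ be the set of its labellings. Let $\Delta\subset\mathbb{R}^d$ be a non-empty compact set with $f_\lambda^i(\Delta)\subseteq\Delta$ for all $\lambda\in\Lambda$ and $1\le i\le\mathcal N(\lambda)$. For $\tau\in\mathcal T$ put \[ F_\tau=\bigcap_{n\ge1}\ \bigcup_{(v_1,\dots,v_n)} f^{v_1}_{\tau(())}\circ f^{v_2}_{\tau((v_1))}\circ\cdots\circ f^{v_n}_{\tau((v_1,\dots,v_{n-1}))}(\Delta), \] where the union is over all $(v_1,\dots,v_n)\in\{1,\dots,\mathcal N\}^n$ with $v_j\le\mathcal N(\tau((v_1,\dots,v_{j-1})))$ for $1\le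 j\le n$. The random homogeneous ($1$-variable) measure $\mathbb P_1$ on $\mathcal T$ is the law of the labelling $v\mapsto\lambda_{|v|}$, where $|v|$ is the level of the node $v$ and $\lambda_0,\lambda_1,\dots$ are independent with distribution $\mu$. For a bounded set $F\subset\mathbb{R}^d$ of diameter $|F|$ let $N_r(X)$ be the minimal number of sets of diameter at most $r$ that cover $X$, let $N_{r,R}(F)=\sup_{x\in F}N_r(B(x,R)\cap F)$ with open balls $B(x,R)$, and for $\delta>0$ let \[ h(\delta,F)=\inf\{\alpha\ge0 \mid \exists C>0\ \forall r,R>0:\ r\le R^{1+\delta}\le|F|\Rightarrow N_{r,R}(F)\le C(R/r)^\alpha\}. \] The quasi-Assouad dimension of $F$ is $\dim_{qA}F=\lim_{\delta\to0^+}h(\delta,F)$, and $\dim_H$ denotes the Hausdorff dimension. \textbf{Theorem.} Let $(\mathbb L,\mu)$ be a non-extinguishing RIFS that satisfies the UOSC and the contraction condition, and assume $\mu(\{0\})=0$. Then, for $\mathbb P_1$-almost every $\tau\in\mathcal T$, the limit defining $\dim_{qA}F_\tau$ exists and \[ \dim_{qA}F_\tau=\dim_HF_\tau . \] -/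

import Mathlib

open Set Filter Topology MeasureTheory
open scoped NNReal ENNReal

/-! ### Covering numbers and the quasi-Assouad dimension -/

/-- `N_r(X)`: the minimal number of sets of diameter at most `r` needed to cover `X`
(`⊤` if there is no finite cover). -/
noncomputable def coverNum {M : Type*} [MetricSpace M] (r : ℝ) (X : Set M) : ℕ∞ :=
  ⨅ (𝒰 : Set (Set M)) (_ : X ⊆ ⋃₀ 𝒰) (_ : ∀ U ∈ 𝒰, Metric.ediam U ≤ ENNReal.ofReal r), 𝒰.encard

/-- `N_{r,R}(F) = max_{x ∈ F} N_r(B(x,R) ∩ F)`. -/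
noncomputable def localCoverNum {M : Type*} [MetricSpace M] (r R : ℝ) (F : Set M) : ℕ∞ :=
  ⨆ x ∈ F, coverNum r (Metric.ball x R ∩ F)

/-- `h(δ,F)`: the infimum of all exponents `α ≥ 0` for which there is `C > 0` such that
`N_{r,R}(F) ≤ C (R/r)^α` whenever `0 < r ≤ R^(1+δ) ≤ |F|`. -/
noncomputable def assouadExponent {M : Type*} [MetricSpace M] (δ : ℝ) (F : Set M) : ℝ≥0∞ :=
  ⨅ (α : ℝ≥0) (_ : ∃ C : ℝ, 0 < C ∧ ∀ r R : ℝ, 0 < r → 0 < R → r ≤ R ^ (1 + δ) →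
      R ^ (1 + δ) ≤ Metric.diam F →
      (localCoverNum r R F : ℝ≥0∞) ≤ ENNReal.ofReal (C * (R / r) ^ (α : ℝ))), (α : ℝ≥0∞)

/-- The quasi-Assouad dimension `lim_{δ → 0+} h(δ,F)` of `F` exists and is equal to `s`. -/
def IsQuasiAssouadDim {M : Type*} [MetricSpace M] (F : Set M) (s : ℝ≥0∞) : Prop :=
  Tendsto (fun δ : ℝ => assouadExponent δ F) (𝓝[>] 0) (𝓝 s)

/-! ### Random iterated function systems -/

/-- A random iterated function system of similarities of `ℝ^d`, indexed by a compact set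
`Λ ⊆ ℝ^k` that carries a Borel probability measure `μ`. The iterated function system with
index `l` consists of the maps `map l i` with `i < numMaps l`; the other values of `map l` and
`ratio l` are never used. -/
structure RIFS (k d : ℕ) where
  /-- the index set -/
  Λ : Set (EuclideanSpace ℝ (Fin k))
  isCompact_Λ : IsCompact Λ
  /-- the distribution of the index -/
  μ : Measure Λ
  isProbabilityMeasure_μ : IsProbabilityMeasure μ
  /-- a common upper bound for the number of maps -/
  maxMaps : ℕ
  /-- the number of maps of each iterated function system -/
  numMaps : Λ → ℕ
  numMaps_le : ∀ l, numMaps l ≤ maxMaps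
  /-- `0`, if it belongs to `Λ`, is an isolated point of `Λ` -/
  isolated_zero : ¬ AccPt (0 : EuclideanSpace ℝ (Fin k)) (𝓟 Λ)
  /-- `0` is the only index of an empty iterated function system -/
  numMaps_eq_zero_iff : ∀ l : Λ, numMaps l = 0 ↔ (l : EuclideanSpace ℝ (Fin k)) = 0
  map : Λ → Fin maxMaps → EuclideanSpace ℝ (Fin d) → EuclideanSpace ℝ (Fin d)
  /-- the contraction rates -/
  ratio : Λ → Fin maxMaps → ℝ
  dist_map : ∀ (l : Λ) (i : Fin maxMaps), (i : ℕ) < numMaps l →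
    ∀ x y, dist (map l i x) (map l i y) = ratio l i * dist x y
  /-- the number of maps is a random variable -/
  measurable_numMaps : Measurable numMaps
  /-- the contraction rates are random variables -/
  measurable_ratio : ∀ i : Fin maxMaps,
    Measurable fun l => if (i : ℕ) < numMaps l then ratio l i else 0

namespace RIFS

variable {k d : ℕ} (L : RIFS k d)

/-- All contraction rates lie in some `[c_min, c_max]` with `0 < c_min ≤ c_max < 1`. -/
def ContractionCondition : Prop :=
  ∃ cmin cmax : ℝ, 0 < cmin ∧ cmin ≤ cmax ∧ cmax < 1 ∧
    ∀ (l : L.Λ) (i : Fin L.maxMaps), (i : ℕ) < L.numMaps l →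
      cmin ≤ L.ratio l i ∧ L.ratio l i ≤ cmax

/-- The expected number of maps exceeds `1`. -/
def NonExtinguishing : Prop :=
  1 < ∫ l, (L.numMaps l : ℝ) ∂L.μ

/-- The uniform open set condition. -/
def UOSC : Prop :=
  ∃ O : Set (EuclideanSpace ℝ (Fin d)), IsOpen O ∧ O.Nonempty ∧
    (∀ (l : L.Λ) (i : Fin L.maxMaps), (i : ℕ) < L.numMaps l → L.map l i '' O ⊆ O) ∧
    (∀ (l : L.Λ) (i j : Fin L.maxMaps), (i : ℕ) < L.numMaps l → (j : ℕ) < L.numMaps l →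
      (L.map l i '' O ∩ L.map l j '' O).Nonempty → i = j)

/-- Nodes of the rooted tree in which every node has `maxMaps` children. The root is `[]`, the
first entry of a node is the branch taken at the root. -/
abbrev Node : Type := List (Fin L.maxMaps)

/-- Labellings of the tree by elements of `Λ`. -/
abbrev Labelling : Type := L.Node → L.Λ

/-- The letter `e_l^j` that represents the map `map l j`. -/
abbrev Letter : Type := L.Λ × Fin L.maxMaps

variable {L}

/-- The letter `e_l^j`, or `none` (extinction) if the system `l` has no `j`-th map. -/
def letter (l : L.Λ) (j : Fin L.maxMaps) : Option L.Letter :=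
  if (j : ℕ) < L.numMaps l then some (l, j) else none

/-- The label of a node in the coding tree of `τ`: the concatenation of the letters along the
path from the root to the node, where `none` annihilates. The tree `fun w => τ (j :: w)` is the
full subtree of `τ` at the child `j` of the root. -/
def coding (τ : L.Labelling) : L.Node → Option (List L.Letter)
  | [] => some []
  | j :: v => Option.map₂ List.cons (letter (τ []) j) (coding (fun w => τ (j :: w)) v)

/-- The (non-extinct) codings at level `n` of the coding tree of `τ`. -/
def codingsAt (τ : L.Labelling) (n : ℕ) : Set (List L.Letter) :=
  {e | ∃ v : L.Node, v.length = n ∧ coding τ v = some e}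

/-- The composition `f_{e_1} ∘ f_{e_2} ∘ ⋯ ∘ f_{e_n}` that belongs to a coding. -/
def codingMap : List L.Letter → EuclideanSpace ℝ (Fin d) → EuclideanSpace ℝ (Fin d)
  | [] => id
  | a :: e => L.map a.1 a.2 ∘ codingMap e

/-- The attractor `F_τ`, built from the compact set `Δ`. -/
def attractor (Δ : Set (EuclideanSpace ℝ (Fin d))) (τ : L.Labelling) :
    Set (EuclideanSpace ℝ (Fin d)) :=
  ⋂ (n : ℕ) (_ : 1 ≤ n), ⋃ e ∈ codingsAt τ n, codingMap e '' Δ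

variable (L)

/-- `Δ` is a non-empty compact set that every map of every system maps into itself. -/
def IsAdmissible (Δ : Set (EuclideanSpace ℝ (Fin d))) : Prop :=
  IsCompact Δ ∧ Δ.Nonempty ∧
    ∀ (l : L.Λ) (i : Fin L.maxMaps), (i : ℕ) < L.numMaps l → L.map l i '' Δ ⊆ Δ

/-- The random homogeneous measure `P₁` on labellings: independent `μ`-distributed labels are
chosen for the levels of the tree, and each node receives the label of its level. -/
noncomputable def homogeneousMeasure : Measure L.Labelling :=
  haveI := L.isProbabilityMeasure_μ
  (Measure.infinitePi fun _ : ℕ => L.μ).map fun ω v => ω v.length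

end RIFS

/-! ### Measures of almost constant local dimension -/

/-! Almost surely no level is extinct, so the attractor is the limit set of a non-autonomous system
that uses the family `ω j` at level `j`. Let `T_l(t)` be the sum of the `t`-th powers of the ratios
of `l`, and choose `s > 0` with `∫ log T_l(s) dμ = 0` (`exists_integral_log_total_eq_zero`).
Distributing mass at level `j` in proportion to `ratio ^ s` gives a cylinder of length `m` the mass
`rate ^ s * exp (-∑_{j<m} log T_{ω j}(s))`. By the strong law the sum is `o(m)`, and a cylinder
stopped at size `ρ` has length `O(log (1/ρ))`, so its mass is `ρ ^ (s ± ε)` up to constants. By the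
open set condition a set of diameter `ρ` meets boundedly many such pieces, hence the projected
measure is almost regular (`isAlmostRegular_map`).

Almost regularity yields `dim_H ≥ s` by mass distribution and `N_{r,R} ≤ C R^(s-ε) / r^(s+ε)` by
packing. The error `R^(-2ε)` would be fatal for the Assouad dimension, but under `r ≤ R^(1+δ)` it is
at most `(R/r)^(2ε/δ)` (`rpow_div_rpow_le`); letting `ε → 0` with `δ` fixed gives `h(δ,F) ≤ s`. As
`dim_H F ≤ h(δ,F)` for every bounded `F`, the function `h(·,F)` is constant, equal to `dim_H F`. -/

lemma encard_mul_le_measure {M : Type*} [PseudoMetricSpace M] [MeasurableSpace M]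
    [OpensMeasurableSpace M] (ν : Measure M) {C V : Set M} {ρ : ℝ} {m : ℝ≥0∞}
    (hdisj : C.PairwiseDisjoint (Metric.ball · ρ)) (hm : ∀ y ∈ C, m ≤ ν (Metric.ball y ρ))
    (hV : ∀ y ∈ C, Metric.ball y ρ ⊆ V) : (C.encard : ℝ≥0∞) * m ≤ ν V := by
  calc (C.encard : ℝ≥0∞) * m = ∑' _ : C, m := by rw [ENNReal.tsum_set_const]
    _ ≤ ∑' y : C, ν (Metric.ball (y : M) ρ) := ENNReal.tsum_le_tsum fun y => hm y y.2
    _ ≤ ν (⋃ y : C, Metric.ball (y : M) ρ) :=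
        tsum_meas_le_meas_iUnion_of_disjoint ν (fun _ => measurableSet_ball)
          fun a b hab => hdisj a.2 b.2 (fun h => hab (Subtype.ext h))
    _ ≤ ν V := measure_mono (iUnion_subset fun y => hV y y.2)

/-- Closed balls of radius `r / 2` have diameter at most `r`, and a maximal `r / 2`-separated set is
an `r / 2`-net. -/
lemma coverNum_le_packingNumber {M : Type*} [MetricSpace M] (r : ℝ≥0) (X : Set M) :
    coverNum r X ≤ Metric.packingNumber (r / 2) X := by
  refine le_trans ?_ (Metric.coveringNumber_le_packingNumber _ _)
  refine le_iInf₂ fun C hC => le_iInf fun hcov => ?_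
  refine le_trans (iInf₂_le ((fun y => Metric.closedBall y (r / 2 : ℝ≥0)) '' C) ?_)
    (le_trans (iInf_le _ ?_) (encard_image_le _ _))
  · rw [sUnion_image]
    exact hcov.subset_iUnion_closedBall
  · rintro _ ⟨y, -, rfl⟩
    refine Metric.ediam_le fun a ha b hb => ?_
    rw [edist_dist]
    refine ENNReal.ofReal_le_ofReal ?_
    have h1 := Metric.mem_closedBall.1 ha
    have h2 := Metric.mem_closedBall.1 hb
    have h3 := dist_triangle_right a b y
    push_cast at h1 h2
    linarith

/-- The mass distribution principle. -/
lemma le_dimH_of_measure_le {M : Type*} [MetricSpace M] [MeasurableSpace M] [BorelSpace M]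
    (ν : Measure M) {F : Set M} (hF : ν F ≠ 0) {t : ℝ≥0} (ht : 0 < t) {C : ℝ} (hC : 0 < C)
    (hν : ∀ (U : Set M) (ρ : ℝ), 0 < ρ → Metric.ediam U ≤ ENNReal.ofReal ρ →
      ν U ≤ ENNReal.ofReal (C * ρ ^ (t : ℝ))) : (t : ℝ≥0∞) ≤ dimH F := by
  have ht' : (0 : ℝ) < t := ht
  have key : ∀ U : Set M, Metric.ediam U ≤ 1 →
      ν U ≤ ENNReal.ofReal C * Metric.ediam U ^ (t : ℝ) := by
    intro U hU
    have hfin : Metric.ediam U ≠ ⊤ := ne_top_of_le_ne_top ENNReal.one_ne_top hU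
    set D := (Metric.ediam U).toReal with hD
    have hUD : Metric.ediam U = ENNReal.ofReal D := (ENNReal.ofReal_toReal hfin).symm
    have hD0 : 0 ≤ D := ENNReal.toReal_nonneg
    -- The bound is assumed only for `ρ > 0`, so sets of diameter `0` are reached by letting `ρ`
    -- decrease to `D`.
    have hlim : Tendsto (fun ρ : ℝ => ENNReal.ofReal (C * ρ ^ (t : ℝ))) (𝓝[>] D)
        (𝓝 (ENNReal.ofReal (C * D ^ (t : ℝ)))) := by
      refine ENNReal.tendsto_ofReal (Tendsto.const_mul _ ?_)
      exact ((Real.continuousAt_rpow_const D t (Or.inr ht'.le)).tendsto).mono_left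
        nhdsWithin_le_nhds
    rw [hUD, ENNReal.ofReal_rpow_of_nonneg hD0 ht'.le, ← ENNReal.ofReal_mul hC.le]
    refine ge_of_tendsto hlim ?_
    filter_upwards [self_mem_nhdsWithin] with ρ hρ
    have hρ' : D < ρ := hρ
    exact hν U ρ (hD0.trans_lt hρ') (hUD ▸ ENNReal.ofReal_le_ofReal hρ'.le)
  have hC0 : ENNReal.ofReal C ≠ 0 := by simpa using hC
  have hle : (ENNReal.ofReal C)⁻¹ • ν ≤ μH[(t : ℝ)] := by
    refine Measure.le_hausdorffMeasure _ _ 1 one_pos fun U hU => ?_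
    rw [Measure.smul_apply, smul_eq_mul]
    calc _ ≤ (ENNReal.ofReal C)⁻¹ * (ENNReal.ofReal C * Metric.ediam U ^ (t : ℝ)) := by
          gcongr; exact key U hU
      _ = _ := by rw [← mul_assoc, ENNReal.inv_mul_cancel hC0 ENNReal.ofReal_ne_top, one_mul]
  refine le_dimH_of_hausdorffMeasure_ne_zero fun h0 => hF ?_
  have := Measure.le_iff'.1 hle F
  rw [h0, Measure.smul_apply, smul_eq_mul, nonpos_iff_eq_zero, mul_eq_zero] at this
  exact this.resolve_left (by simp)

/-- Optimal covers at the scales `ρ₀ / (n + 1)` have `α`-sums at most `C`, so `μH[α] X ≤ C`. -/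
lemma dimH_le_of_coverNum_le {M : Type*} [MetricSpace M] {X : Set M} {α : ℝ≥0} {C ρ₀ : ℝ}
    (hρ₀ : 0 < ρ₀)
    (h : ∀ r : ℝ, 0 < r → r ≤ ρ₀ → (coverNum r X : ℝ≥0∞) ≤ ENNReal.ofReal (C * r ^ (-(α : ℝ)))) :
    dimH X ≤ α := by
  borelize M
  refine dimH_le_of_hausdorffMeasure_ne_top
    (ne_top_of_le_ne_top (ENNReal.ofReal_ne_top (r := C)) ?_)
  have hex : ∀ n : ℕ, ∃ 𝒰 : Set (Set M), X ⊆ ⋃₀ 𝒰 ∧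
      (∀ U ∈ 𝒰, Metric.ediam U ≤ ENNReal.ofReal (ρ₀ / (n + 1))) ∧
      (𝒰.encard : ℝ≥0∞) ≤ ENNReal.ofReal (C * (ρ₀ / (n + 1)) ^ (-(α : ℝ))) := by
    intro n
    have hr : 0 < ρ₀ / ((n : ℝ) + 1) := by positivity
    have hle := h _ hr (div_le_self hρ₀.le (by linarith [n.cast_nonneg (α := ℝ)]))
    have hne : coverNum (ρ₀ / ((n : ℝ) + 1)) X ≠ ⊤ := by
      intro htop
      rw [htop] at hle
      exact absurd hle (by simp)
    -- The infimum in `ℕ∞` is attained; a minimiser that is not an admissible cover would make it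
    -- `⊤`.
    obtain ⟨𝒰, h1⟩ := ENat.exists_eq_iInf (fun 𝒰 : Set (Set M) =>
      ⨅ (_ : X ⊆ ⋃₀ 𝒰) (_ : ∀ U ∈ 𝒰, Metric.ediam U ≤ ENNReal.ofReal (ρ₀ / ((n : ℝ) + 1))),
        𝒰.encard)
    by_cases hc : X ⊆ ⋃₀ 𝒰
    · by_cases hd : ∀ U ∈ 𝒰, Metric.ediam U ≤ ENNReal.ofReal (ρ₀ / ((n : ℝ) + 1))
      · refine ⟨𝒰, hc, hd, ?_⟩
        have : 𝒰.encard = coverNum (ρ₀ / ((n : ℝ) + 1)) X := by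
          rw [coverNum, ← h1, iInf_pos hc, iInf_pos hd]
        rwa [this]
      · exact absurd (by rw [coverNum, ← h1, iInf_pos hc, iInf_neg hd]) hne
    · exact absurd (by rw [coverNum, ← h1, iInf_neg hc]) hne
  choose 𝒰 hcov hdiam hcard using hex
  have hcount : ∀ n, Countable (𝒰 n) := by
    intro n
    have : (𝒰 n).encard ≠ ⊤ := by
      intro htop
      have := hcard n
      rw [htop] at this
      exact absurd this (by simp)
    exact (Set.encard_ne_top_iff.1 this).countable
  have hlim : Tendsto (fun n : ℕ => ENNReal.ofReal (ρ₀ / ((n : ℝ) + 1))) atTop (𝓝 0) := by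
    rw [← ENNReal.ofReal_zero]
    refine ENNReal.tendsto_ofReal ?_
    simpa [div_eq_mul_inv] using
      (tendsto_one_div_add_atTop_nhds_zero_nat (𝕜 := ℝ)).const_mul ρ₀
  refine (Measure.hausdorffMeasure_le_liminf_tsum (ι := fun n => 𝒰 n) (α : ℝ) X _ hlim
    (fun n U => (U : Set M)) (Eventually.of_forall fun n U => hdiam n U U.2)
    (Eventually.of_forall fun n => by rw [← sUnion_eq_iUnion]; exact hcov n)).trans ?_
  refine liminf_le_of_frequently_le' (Frequently.of_forall fun n => ?_)
  have hr : 0 < ρ₀ / ((n : ℝ) + 1) := by positivity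
  calc ∑' U : 𝒰 n, Metric.ediam (U : Set M) ^ (α : ℝ)
      ≤ ∑' _ : 𝒰 n, ENNReal.ofReal ((ρ₀ / ((n : ℝ) + 1)) ^ (α : ℝ)) := by
        refine ENNReal.tsum_le_tsum fun U => ?_
        rw [← ENNReal.ofReal_rpow_of_pos hr]
        exact ENNReal.rpow_le_rpow (hdiam n U U.2) α.2
    _ = (𝒰 n).encard * ENNReal.ofReal ((ρ₀ / ((n : ℝ) + 1)) ^ (α : ℝ)) := by
        rw [ENNReal.tsum_set_const]
    _ ≤ ENNReal.ofReal (C * (ρ₀ / (n + 1)) ^ (-(α : ℝ))) *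
          ENNReal.ofReal ((ρ₀ / ((n : ℝ) + 1)) ^ (α : ℝ)) := by gcongr; exact hcard n
    _ = ENNReal.ofReal C := by
        rw [← ENNReal.ofReal_mul' (by positivity), mul_assoc, ← Real.rpow_add hr]
        simp

/-- A single `R`, the largest admissible one, suffices: with `R` fixed and `r → 0` the exponent
bounds the dimension of each piece `B(x,R) ∩ F`, and countably many pieces cover `F`. -/
lemma dimH_le_assouadExponent {M : Type*} [MetricSpace M] [SecondCountableTopology M]
    {F : Set M} (hF : Bornology.IsBounded F) {δ : ℝ} (hδ : 0 < δ) :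
    dimH F ≤ assouadExponent δ F := by
  refine le_iInf₂ fun α hα => ?_
  obtain ⟨C, hC, h⟩ := hα
  rcases (Metric.diam_nonneg (s := F)).eq_or_lt with h0 | hpos
  · rw [dimH_subsingleton]
    · exact zero_le
    · intro x hx y hy
      have := Metric.dist_le_diam_of_mem hF hx hy
      exact dist_le_zero.1 (h0 ▸ this)
  set R := Metric.diam F ^ (1 + δ)⁻¹ with hR
  have hR0 : 0 < R := Real.rpow_pos_of_pos hpos _
  have hRδ : R ^ (1 + δ) = Metric.diam F := Real.rpow_inv_rpow hpos.le (by linarith)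
  have hball : ∀ x ∈ F, dimH (Metric.ball x R ∩ F) ≤ α := by
    intro x hx
    refine dimH_le_of_coverNum_le (C := C * R ^ (α : ℝ)) (ρ₀ := Metric.diam F) hpos ?_
    intro r hr hrD
    have h1 : coverNum r (Metric.ball x R ∩ F) ≤ localCoverNum r R F :=
      le_iSup₂ (f := fun x (_ : x ∈ F) => coverNum r (Metric.ball x R ∩ F)) x hx
    have h2 := h r R hr hR0 (hRδ ▸ hrD) hRδ.le
    refine le_trans (by exact_mod_cast h1) (h2.trans (le_of_eq ?_))
    rw [Real.div_rpow hR0.le hr.le, Real.rpow_neg hr.le, mul_assoc, div_eq_mul_inv]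
  obtain ⟨t, htF, htc, hcov⟩ := TopologicalSpace.countable_cover_nhdsWithin
    (f := fun x => Metric.ball x R) (s := F)
    (fun x _ => mem_nhdsWithin_of_mem_nhds (Metric.ball_mem_nhds x hR0))
  calc dimH F ≤ dimH (⋃ x ∈ t, Metric.ball x R ∩ F) := by
        refine dimH_mono fun y hy => ?_
        obtain ⟨x, hx, hyx⟩ := mem_iUnion₂.1 (hcov hy)
        exact mem_iUnion₂.2 ⟨x, hx, hyx, hy⟩
    _ = ⨆ x ∈ t, dimH (Metric.ball x R ∩ F) := dimH_bUnion htc _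
    _ ≤ α := iSup₂_le fun x hx => hball x (htF hx)

/-- `ν` has, up to arbitrarily small errors in the exponent, uniform local dimension `s` on `F`. -/
structure IsAlmostRegular {M : Type*} [MetricSpace M] [MeasurableSpace M] (ν : Measure M)
    (F : Set M) (s : ℝ) : Prop where
  le_measure_ball : ∀ ε : ℝ, 0 < ε → ∃ c : ℝ, 0 < c ∧ ∀ x ∈ F, ∀ r : ℝ, 0 < r → r ≤ 1 →
    ENNReal.ofReal (c * r ^ (s + ε)) ≤ ν (Metric.ball x r)
  measure_le : ∀ ε : ℝ, 0 < ε → ε < s → ∃ C : ℝ, 0 < C ∧ ∀ (U : Set M) (ρ : ℝ), 0 < ρ →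
    Metric.ediam U ≤ ENNReal.ofReal ρ → ν U ≤ ENNReal.ofReal (C * ρ ^ (s - ε))

/-- The scale gap gives `R ^ (-δ) ≤ R / r`, which pays for the surplus factor `R ^ (-2ε)` by a small
power of `R / r`. -/
lemma rpow_div_rpow_le {r R s ε δ : ℝ} (hr : 0 < r) (hR : 0 < R) (hε : 0 < ε) (hδ : 0 < δ)
    (hrR : r ≤ R ^ (1 + δ)) :
    R ^ (s - ε) / r ^ (s + ε) ≤ (R / r) ^ (s + ε * (1 + 2 / δ)) := by
  have h1 : R ^ (-δ) ≤ R / r := by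
    rw [le_div_iff₀ hr, ← le_div_iff₀' (by positivity), Real.rpow_neg hR.le, div_inv_eq_mul]
    rwa [Real.rpow_add hR, Real.rpow_one] at hrR
  have h2 : R ^ (-(2 * ε)) ≤ (R / r) ^ (ε * (2 / δ)) := by
    calc R ^ (-(2 * ε)) = (R ^ (-δ)) ^ (ε * (2 / δ)) := by
          rw [← Real.rpow_mul hR.le]; congr 1; field_simp
      _ ≤ _ := by gcongr
  calc R ^ (s - ε) / r ^ (s + ε) = (R / r) ^ (s + ε) * R ^ (-(2 * ε)) := by
        rw [Real.div_rpow hR.le hr.le, div_mul_eq_mul_div, ← Real.rpow_add hR]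
        congr 2; ring
    _ ≤ (R / r) ^ (s + ε) * (R / r) ^ (ε * (2 / δ)) := by gcongr
    _ = _ := by rw [← Real.rpow_add (by positivity)]; congr 1; ring

namespace IsAlmostRegular

variable {M : Type*} [MetricSpace M] [MeasurableSpace M] [BorelSpace M] {ν : Measure M}
  {F : Set M} {s : ℝ}

lemma le_dimH (h : IsAlmostRegular ν F s) (hF : ν F ≠ 0) : ENNReal.ofReal s ≤ dimH F := by
  refine ENNReal.le_of_forall_nnreal_lt fun t ht => ?_
  rcases eq_or_ne t 0 with rfl | ht0
  · simp
  have ht' : (0 : ℝ) < t := lt_of_le_of_ne t.2 (fun h => ht0 (NNReal.eq h.symm))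
  have hts : (t : ℝ) < s := by
    rw [ENNReal.lt_ofReal_iff_toReal_lt ENNReal.coe_ne_top] at ht
    simpa using ht
  obtain ⟨C, hC, hν⟩ := h.measure_le (s - t) (by linarith) (by linarith)
  exact le_dimH_of_measure_le ν hF (pos_of_ne_zero ht0) hC (by simpa using hν)

lemma assouadExponent_le (h : IsAlmostRegular ν F s) (hs : 0 < s) {δ : ℝ} (hδ : 0 < δ) :
    assouadExponent δ F ≤ ENNReal.ofReal s := by
  refine ENNReal.le_of_forall_pos_le_add fun η hη _ => ?_
  have hη' : (0 : ℝ) < η := hη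
  obtain ⟨ε, hε, hεs, hεη⟩ : ∃ ε : ℝ, 0 < ε ∧ ε < s ∧ ε * (1 + 2 / δ) ≤ η := by
    have hk : 0 < 1 + 2 / δ := by positivity
    refine ⟨min (s / 2) (η / (1 + 2 / δ)), by positivity, ?_, ?_⟩
    · exact (min_le_left _ _).trans_lt (by linarith)
    · rw [← le_div_iff₀ hk]; exact min_le_right _ _
  obtain ⟨c, hc, hlow⟩ := h.le_measure_ball ε hε
  obtain ⟨C, hC, hup⟩ := h.measure_le ε hε hεs
  have hα0 : 0 ≤ s + ε * (1 + 2 / δ) := by positivity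
  set D := Metric.diam F with hD
  have hD0 : 0 ≤ D := Metric.diam_nonneg
  -- all admissible scales are below `B`
  set B := 1 + D with hB
  have hB1 : 1 ≤ B := by linarith
  -- From `r ≤ R * R ^ δ ≤ R * B ^ δ` the ball of radius `R + r` has diameter at most `K * R`.
  set K := 2 * (1 + B ^ δ) with hK
  have hK0 : 0 < K := by positivity
  obtain ⟨α, hα⟩ : ∃ α : ℝ≥0, (α : ℝ) = s + ε * (1 + 2 / δ) := ⟨⟨_, hα0⟩, rfl⟩
  have hbound : assouadExponent δ F ≤ α := by
    refine iInf₂_le α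
      ⟨C * K ^ (s - ε) / (c * (4 * B) ^ (-(s + ε))), by positivity, ?_⟩
    intro r R hr hR hrR hRD
    have hRB : R ≤ B := by
      by_contra hcon
      push Not at hcon
      have h1 : R ^ (1 : ℝ) ≤ R ^ (1 + δ) :=
        Real.rpow_le_rpow_of_exponent_le (by linarith) (by linarith)
      rw [Real.rpow_one] at h1
      linarith
    have hrRB : r ≤ R * B ^ δ := by
      refine hrR.trans ?_
      rw [Real.rpow_add hR, Real.rpow_one]
      gcongr
    have hrB : r ≤ B := by linarith
    have hpack : ∀ x ∈ F, ∀ T ⊆ Metric.ball x R ∩ F, Metric.IsSeparated (r.toNNReal / 2 : ℝ≥0) T →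
        (T.encard : ℝ≥0∞) ≤ ENNReal.ofReal
          (C * K ^ (s - ε) / (c * (4 * B) ^ (-(s + ε))) * (R / r) ^ (α : ℝ)) := by
      intro x hx T hT hsep
      -- The factor `4` makes balls around `r / 2`-separated points disjoint; `B` brings the radius
      -- below `1`, where the lower mass bound applies.
      have hρ : 0 < r / (4 * B) := by positivity
      have hρr : r / (4 * B) ≤ r / 4 := by gcongr; linarith
      have hle := encard_mul_le_measure ν (C := T) (V := Metric.ball x (R + r))
        (ρ := r / (4 * B)) (m := ENNReal.ofReal (c * (r / (4 * B)) ^ (s + ε))) ?_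
        (fun y hy => hlow y (hT hy).2 _ hρ ?_) (fun y hy => ?_)
      · have hdiam : Metric.ediam (Metric.ball x (R + r)) ≤ ENNReal.ofReal (K * R) := by
          refine Metric.ediam_le fun a ha b hb => ?_
          rw [edist_dist]
          refine ENNReal.ofReal_le_ofReal ?_
          have h1 := Metric.mem_ball.1 ha
          have h2 := Metric.mem_ball.1 hb
          have h3 := dist_triangle_right a b x
          rw [hK]
          linarith
        have hle2 := hle.trans (hup _ _ (by positivity) hdiam)
        have hm : 0 < c * (r / (4 * B)) ^ (s + ε) := by positivity
        rw [← ENNReal.le_div_iff_mul_le (Or.inl (by simpa using hm))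
          (Or.inl ENNReal.ofReal_ne_top), ← ENNReal.ofReal_div_of_pos hm] at hle2
        refine hle2.trans (ENNReal.ofReal_le_ofReal ?_)
        have hq := rpow_div_rpow_le hr hR hε hδ hrR (s := s)
        rw [hα, Real.div_rpow hr.le (by positivity), Real.mul_rpow hK0.le hR.le,
          Real.rpow_neg (by positivity)]
        calc _ = C * K ^ (s - ε) / (c * ((4 * B) ^ (s + ε))⁻¹) * (R ^ (s - ε) / r ^ (s + ε)) := by
              field_simp
          _ ≤ _ := by gcongr
      · intro y hy z hz hyz
        refine Metric.ball_disjoint_ball ?_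
        have h1 : ((r.toNNReal / 2 : ℝ≥0) : ℝ≥0∞) < edist y z := hsep hy hz hyz
        rw [edist_dist, ← ENNReal.ofReal_coe_nnreal, ENNReal.ofReal_lt_ofReal_iff_of_nonneg
          (NNReal.coe_nonneg _)] at h1
        push_cast at h1
        rw [Real.coe_toNNReal r hr.le] at h1
        linarith
      · rw [div_le_one (by positivity)]
        linarith
      · refine Metric.ball_subset_ball' ?_
        have := Metric.mem_ball.1 (hT hy).1
        linarith
    rw [localCoverNum, ENat.toENNReal_iSup]
    refine iSup_le fun x => ?_
    rw [ENat.toENNReal_iSup]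
    refine iSup_le fun hx => ?_
    have hcov := coverNum_le_packingNumber r.toNNReal (Metric.ball x R ∩ F)
    rw [Real.coe_toNNReal r hr.le] at hcov
    refine (ENat.toENNReal_le.2 hcov).trans ?_
    rw [Metric.packingNumber, ENat.toENNReal_iSup]
    refine iSup_le fun T => ?_
    rw [ENat.toENNReal_iSup]
    refine iSup_le fun hT => ?_
    rw [ENat.toENNReal_iSup]
    exact iSup_le fun hsep => hpack x hx T hT hsep
  refine hbound.trans ?_
  rw [← ENNReal.ofReal_coe_nnreal (p := η), ← ENNReal.ofReal_add hs.le hη'.le,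
    ← ENNReal.ofReal_coe_nnreal]
  exact ENNReal.ofReal_le_ofReal (by rw [hα]; linarith)

theorem isQuasiAssouadDim [SecondCountableTopology M] (h : IsAlmostRegular ν F s) (hs : 0 < s)
    (hF : ν F ≠ 0) (hb : Bornology.IsBounded F) : IsQuasiAssouadDim F (dimH F) := by
  refine Tendsto.congr' ?_ tendsto_const_nhds
  filter_upwards [self_mem_nhdsWithin] with δ hδ
  exact le_antisymm (dimH_le_assouadExponent hb hδ)
    ((h.assouadExponent_le hs hδ).trans (h.le_dimH hF))

end IsAlmostRegular

/-! ### Non-autonomous iterated function systems of similarities -/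

/-- The point is surjectivity: after rescaling, `f` is an isometry of a strictly convex space, hence
affine, hence onto by finite dimension. -/
lemma image_ball_of_dist_eq {E : Type*} [NormedAddCommGroup E] [InnerProductSpace ℝ E]
    [FiniteDimensional ℝ E] {f : E → E} {c : ℝ} (hc : 0 < c)
    (hf : ∀ x y, dist (f x) (f y) = c * dist x y) (a : E) (η : ℝ) :
    f '' Metric.ball a η = Metric.ball (f a) (c * η) := by
  have hiso : Isometry fun x => f (c⁻¹ • x) := by
    refine Isometry.of_dist_eq fun x y => ?_
    rw [hf, dist_smul₀, norm_inv, Real.norm_of_nonneg hc.le, mul_inv_cancel_left₀ hc.ne']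
  have hsurj : Function.Surjective f := by
    intro y
    let : Inhabited E := ⟨0⟩
    obtain ⟨x, hx⟩ :=
      (hiso.affineIsometryOfStrictConvexSpace.toAffineIsometryEquiv rfl).surjective y
    exact ⟨c⁻¹ • x, by simpa using hx⟩
  ext y
  constructor
  · rintro ⟨x, hx, rfl⟩
    rw [Metric.mem_ball] at hx ⊢
    rw [hf]
    gcongr
  · intro hy
    obtain ⟨x, rfl⟩ := hsurj y
    refine ⟨x, ?_, rfl⟩
    rw [Metric.mem_ball] at hy ⊢
    rw [hf] at hy
    exact lt_of_mul_lt_mul_left hy hc.le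

/-- The size of a `κρ`-separated subset of a ball of radius `Kρ` is bounded independently of `ρ`. -/
lemma exists_encard_le_of_separated (E : Type*) [NormedAddCommGroup E] [NormedSpace ℝ E]
    [FiniteDimensional ℝ E] {K κ : ℝ} (hK : 0 < K) (hκ : 0 < κ) :
    ∃ m : ℕ, ∀ (ρ : ℝ) (x : E) (T : Set E), 0 < ρ → T ⊆ Metric.closedBall x (K * ρ) →
      (T.Pairwise fun y z => κ * ρ ≤ dist y z) → T.encard ≤ m := by
  borelize E
  set n := Module.finrank ℝ E
  refine ⟨⌊((K + κ) / (κ / 2)) ^ n⌋₊, fun ρ x T hρ hT hsep => ?_⟩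
  set ν : Measure E := MeasureTheory.Measure.addHaar
  have hle := encard_mul_le_measure ν (C := T) (ρ := κ / 2 * ρ)
    (m := ENNReal.ofReal ((κ / 2 * ρ) ^ n) * ν (Metric.ball 0 1))
    (V := Metric.ball x ((K + κ) * ρ)) ?_ (fun y _ => ?_) (fun y hy => ?_)
  · have h0 : ν (Metric.ball 0 1) ≠ 0 := (Metric.measure_ball_pos ν 0 one_pos).ne'
    have h1 : ν (Metric.ball 0 1) ≠ ⊤ := measure_ball_lt_top.ne
    have hpos : 0 < (κ / 2 * ρ) ^ n := by positivity
    rw [Measure.addHaar_ball_of_pos ν x (r := (K + κ) * ρ) (by positivity), ← mul_assoc,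
      ENNReal.mul_le_mul_iff_left h0 h1,
      ← ENNReal.le_div_iff_mul_le (Or.inl (by simpa using hpos)) (Or.inl ENNReal.ofReal_ne_top),
      ← ENNReal.ofReal_div_of_pos hpos, ← div_pow, mul_div_mul_right _ _ hρ.ne'] at hle
    have hfin : T.encard ≠ ⊤ := by
      intro htop
      rw [htop] at hle
      exact absurd hle (by simp)
    obtain ⟨k, hk⟩ := ENat.ne_top_iff_exists.1 hfin
    rw [← hk] at hle ⊢
    norm_cast
    refine Nat.le_floor ?_
    rw [ENat.toENNReal_coe, ← ENNReal.ofReal_natCast,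
      ENNReal.ofReal_le_ofReal_iff (by positivity)] at hle
    exact hle
  · intro y hy z hz hyz
    refine Metric.ball_disjoint_ball ?_
    have := hsep hy hz hyz
    linarith
  · rw [Measure.addHaar_ball_of_pos ν y (r := κ / 2 * ρ) (by positivity)]
  · refine Metric.ball_subset_ball' ?_
    have := Metric.mem_closedBall.1 (hT hy)
    nlinarith [mul_pos hκ hρ]

/-- A sequence of finite families of similarities with uniformly bounded contraction rates; the
family used at level `j` is indexed by `ι j`. -/
structure SimilaritySystem (E : Type*) [PseudoMetricSpace E] (ι : ℕ → Type) where
  map : ∀ j, ι j → E → E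
  ratio : ∀ j, ι j → ℝ
  cmin : ℝ
  cmax : ℝ
  cmin_pos : 0 < cmin
  cmax_lt_one : cmax < 1
  cmin_le : ∀ j i, cmin ≤ ratio j i
  le_cmax : ∀ j i, ratio j i ≤ cmax
  dist_map : ∀ j i x y, dist (map j i x) (map j i y) = ratio j i * dist x y

namespace SimilaritySystem

/-! ### Compositions, contraction rates and stopping levels -/

section Basic

variable {E : Type*} [PseudoMetricSpace E] {ι : ℕ → Type} (S : SimilaritySystem E ι)

/-- The composition of the first `m` maps along `ξ`. -/
def comp (ξ : ∀ j, ι j) : ℕ → E → E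
  | 0 => id
  | m + 1 => comp ξ m ∘ S.map m (ξ m)

/-- The contraction rate of the composition of the first `m` maps along `ξ`. -/
noncomputable def rate (ξ : ∀ j, ι j) (m : ℕ) : ℝ := ∏ j ∈ Finset.range m, S.ratio j (ξ j)

/-- The attractor of a non-autonomous iterated function system. -/
def limitSet (Δ : Set E) : Set E := ⋂ (n : ℕ) (_ : 1 ≤ n), ⋃ ξ, S.comp ξ n '' Δ

lemma ratio_pos (j : ℕ) (i : ι j) : 0 < S.ratio j i := S.cmin_pos.trans_le (S.cmin_le j i)

lemma rate_pos (ξ : ∀ j, ι j) (m : ℕ) : 0 < S.rate ξ m :=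
  Finset.prod_pos fun j _ => S.ratio_pos j _

lemma rate_zero (ξ : ∀ j, ι j) : S.rate ξ 0 = 1 := by simp [rate]

lemma rate_succ (ξ : ∀ j, ι j) (m : ℕ) : S.rate ξ (m + 1) = S.rate ξ m * S.ratio m (ξ m) :=
  Finset.prod_range_succ _ _

lemma rate_le_pow (ξ : ∀ j, ι j) (m : ℕ) : S.rate ξ m ≤ S.cmax ^ m := by
  calc S.rate ξ m ≤ ∏ _j ∈ Finset.range m, S.cmax :=
        Finset.prod_le_prod (fun j _ => (S.ratio_pos j _).le) fun j _ => S.le_cmax j _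
    _ = S.cmax ^ m := by simp

lemma dist_comp (ξ : ∀ j, ι j) (m : ℕ) (x y : E) :
    dist (S.comp ξ m x) (S.comp ξ m y) = S.rate ξ m * dist x y := by
  induction m generalizing x y with
  | zero => simp [comp, rate]
  | succ m ih => rw [comp, Function.comp_apply, Function.comp_apply, ih, S.dist_map, rate_succ,
      mul_assoc]

lemma comp_congr {ξ ξ' : ∀ j, ι j} {m : ℕ} (h : ∀ j < m, ξ j = ξ' j) :
    S.comp ξ m = S.comp ξ' m := by
  induction m with
  | zero => rfl
  | succ m ih => rw [comp, comp, ih fun j hj => h j (by omega), h m (by omega)]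

lemma rate_congr {ξ ξ' : ∀ j, ι j} {m : ℕ} (h : ∀ j < m, ξ j = ξ' j) :
    S.rate ξ m = S.rate ξ' m :=
  Finset.prod_congr rfl fun j hj => by rw [h j (Finset.mem_range.1 hj)]

lemma image_comp_subset {O : Set E} (hO : ∀ j i, S.map j i '' O ⊆ O) (ξ : ∀ j, ι j) {m n : ℕ}
    (hmn : m ≤ n) : S.comp ξ n '' O ⊆ S.comp ξ m '' O := by
  induction n, hmn using Nat.le_induction with
  | base => rfl
  | succ n _ ih =>
    refine Subset.trans ?_ ih
    rw [comp, image_comp]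
    exact image_mono (hO n (ξ n))

/-- The first level at which the contraction rate along `ξ` is at most `ρ`. -/
lemma exists_stopping (ξ : ∀ j, ι j) {ρ : ℝ} (hρ : 0 < ρ) (hρ1 : ρ ≤ 1) :
    ∃ m : ℕ, S.cmin * ρ ≤ S.rate ξ m ∧ S.rate ξ m ≤ ρ ∧ (∀ j < m, ρ < S.rate ξ j) ∧
      (m : ℝ) * Real.log S.cmax⁻¹ ≤ Real.log S.cmax⁻¹ + Real.log ρ⁻¹ := by
  classical
  have hmax : 0 < S.cmax := S.cmin_pos.trans_le ((S.cmin_le 0 (ξ 0)).trans (S.le_cmax 0 _))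
  have hlog : 0 ≤ Real.log S.cmax⁻¹ := Real.log_nonneg ((one_le_inv₀ hmax).2 S.cmax_lt_one.le)
  have hex : ∃ m, S.rate ξ m ≤ ρ := by
    obtain ⟨m, hm⟩ := exists_pow_lt_of_lt_one hρ S.cmax_lt_one
    exact ⟨m, (S.rate_le_pow ξ m).trans hm.le⟩
  have hlt : ∀ j < Nat.find hex, ρ < S.rate ξ j := fun j hj => not_le.1 (Nat.find_min hex hj)
  refine ⟨Nat.find hex, ?_, Nat.find_spec hex, hlt, ?_⟩
  · rcases Nat.eq_zero_or_eq_succ_pred (Nat.find hex) with h0 | hs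
    · rw [h0, rate_zero]
      have : S.cmin ≤ 1 := (S.cmin_le 0 (ξ 0)).trans ((S.le_cmax 0 _).trans S.cmax_lt_one.le)
      calc S.cmin * ρ ≤ 1 * 1 := by gcongr
        _ = 1 := one_mul 1
    · rw [hs, Nat.succ_eq_add_one, rate_succ, mul_comm]
      have := hlt (Nat.find hex).pred (by omega)
      exact mul_le_mul this.le (S.cmin_le _ _) S.cmin_pos.le (S.rate_pos _ _).le
  · rcases Nat.eq_zero_or_eq_succ_pred (Nat.find hex) with h0 | hs
    · rw [h0]
      have : 0 ≤ Real.log ρ⁻¹ := Real.log_nonneg ((one_le_inv₀ hρ).2 hρ1)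
      simpa using add_nonneg hlog this
    -- One level before stopping, `ρ < rate ≤ cmax ^ (m - 1)`; taking logarithms bounds `m`.
    · have h1 := (hlt (Nat.find hex).pred (by omega)).le.trans (S.rate_le_pow ξ _)
      have h2 := Real.log_le_log hρ h1
      rw [Real.log_pow] at h2
      rw [hs, Nat.succ_eq_add_one]
      simp only [Real.log_inv]
      push_cast
      linarith

/-- Two branches stopped at the same scale either separate before both stop or agree up to the
common stopping level. -/
lemma stopping_eq {ξ ξ' : ∀ j, ι j} {ρ : ℝ} {m m' : ℕ} (hm : S.rate ξ m ≤ ρ)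
    (hn : S.rate ξ' m' ≤ ρ) (hlt : ∀ j < m, ρ < S.rate ξ j)
    (hlt' : ∀ j < m', ρ < S.rate ξ' j)
    (h : ∀ j, j < m → j < m' → ξ j = ξ' j) : m = m' := by
  rcases lt_trichotomy m m' with hlt1 | heq | hlt1
  · have := S.rate_congr (m := m) fun j hj => h j hj (hj.trans hlt1)
    exact absurd (hlt' m hlt1) (not_lt.2 (this ▸ hm))
  · exact heq
  · have := S.rate_congr (m := m') fun j hj => h j (hj.trans hlt1) hj
    exact absurd (hlt m' hlt1) (not_lt.2 (this ▸ hn))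

/-- Two branches that have separated map an open set of the open set condition to disjoint sets. -/
lemma disjoint_image_comp {O : Set E} (hO : ∀ j i, S.map j i '' O ⊆ O)
    (hdisj : ∀ j i i', (S.map j i '' O ∩ S.map j i' '' O).Nonempty → i = i')
    (hinj : ∀ ξ m, Function.Injective (S.comp ξ m))
    {ξ ξ' : ∀ j, ι j} {m m' : ℕ} (h : ∃ j, j < m ∧ j < m' ∧ ξ j ≠ ξ' j) :
    Disjoint (S.comp ξ m '' O) (S.comp ξ' m' '' O) := by
  classical
  obtain ⟨h1, h2, h3⟩ := Nat.find_spec h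
  have hpre : ∀ j < Nat.find h, ξ j = ξ' j := fun j hj => by
    by_contra hne
    exact Nat.find_min h hj ⟨hj.trans h1, hj.trans h2, hne⟩
  -- Both images shrink with the level, so it suffices to compare them just after the first
  -- disagreement, where the prefix is common and injective.
  refine Disjoint.mono (S.image_comp_subset hO ξ (Nat.succ_le_of_lt h1))
    (S.image_comp_subset hO ξ' (Nat.succ_le_of_lt h2)) ?_
  rw [Nat.succ_eq_add_one, comp, comp, image_comp, image_comp, S.comp_congr hpre,
    disjoint_image_iff (hinj _ _), disjoint_iff_inter_eq_empty]
  by_contra hne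
  exact h3 (hdisj _ _ _ (nonempty_iff_ne_empty.2 hne))

end Basic

/-! ### The projection from branches to points -/

section CodingMap

variable {E : Type*} [MetricSpace E] {ι : ℕ → Type} (S : SimilaritySystem E ι)

lemma comp_injective (ξ : ∀ j, ι j) (m : ℕ) : Function.Injective (S.comp ξ m) := by
  intro x y hxy
  have := S.dist_comp ξ m x y
  rw [hxy, dist_self, eq_comm, mul_eq_zero] at this
  exact dist_eq_zero.1 (this.resolve_left (S.rate_pos ξ m).ne')

lemma continuous_map (j : ℕ) (i : ι j) : Continuous (S.map j i) :=
  (LipschitzWith.of_dist_le_mul (K := (S.ratio j i).toNNReal) fun x y => by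
    rw [S.dist_map, Real.coe_toNNReal _ (S.ratio_pos j i).le]).continuous

lemma continuous_comp (ξ : ∀ j, ι j) (m : ℕ) : Continuous (S.comp ξ m) := by
  induction m with
  | zero => exact continuous_id
  | succ m ih => exact ih.comp (S.continuous_map m _)

lemma measurable_comp [∀ j, Countable (ι j)] [∀ j, MeasurableSpace (ι j)]
    [∀ j, MeasurableSingletonClass (ι j)] [MeasurableSpace E] [BorelSpace E] (m : ℕ)
    {Y : (∀ j, ι j) → E} (hY : Measurable Y) : Measurable fun ξ => S.comp ξ m (Y ξ) := by
  induction m generalizing Y with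
  | zero => exact hY
  | succ m ih =>
    refine ih (Y := fun ξ => S.map m (ξ m) (Y ξ)) ?_
    have h : Measurable fun p : ι m × E => S.map m p.1 p.2 :=
      measurable_from_prod_countable_right fun i => (S.continuous_map m i).measurable
    exact h.comp ((measurable_pi_apply m).prodMk hY)

/-- The projection is the limit of `comp ξ m x₀` for a base point `x₀ ∈ Δ`: the sequence is Cauchy
at a geometric rate, and its tail stays in the compact set `comp ξ m '' Δ`. -/
lemma exists_measurable_codingMap [CompleteSpace E] [∀ j, Countable (ι j)]
    [∀ j, MeasurableSpace (ι j)] [∀ j, MeasurableSingletonClass (ι j)] [MeasurableSpace E]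
    [BorelSpace E] {Δ : Set E} (hc : IsCompact Δ) (hne : Δ.Nonempty)
    (hΔ : ∀ j i, S.map j i '' Δ ⊆ Δ) :
    ∃ π : (∀ j, ι j) → E, Measurable π ∧ ∀ ξ m, π ξ ∈ S.comp ξ m '' Δ := by
  obtain ⟨x₀, hx₀⟩ := hne
  have hmem : ∀ ξ m n, m ≤ n → S.comp ξ n x₀ ∈ S.comp ξ m '' Δ := fun ξ m n hmn =>
    S.image_comp_subset hΔ ξ hmn (mem_image_of_mem _ hx₀)
  have hcauchy : ∀ ξ, CauchySeq fun m => S.comp ξ m x₀ := by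
    intro ξ
    refine cauchySeq_of_le_geometric S.cmax (Metric.diam Δ) S.cmax_lt_one fun m => ?_
    rw [comp, Function.comp_apply, S.dist_comp, mul_comm]
    exact mul_le_mul
      (Metric.dist_le_diam_of_mem hc.isBounded hx₀ (hΔ _ _ (mem_image_of_mem _ hx₀)))
      (S.rate_le_pow ξ m) (S.rate_pos ξ m).le Metric.diam_nonneg
  choose π hπ using fun ξ => cauchySeq_tendsto_of_complete (hcauchy ξ)
  refine ⟨π, ?_, fun ξ m => ?_⟩
  · exact measurable_of_tendsto_metrizable (fun m => S.measurable_comp m measurable_const)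
      (tendsto_pi_nhds.2 hπ)
  · refine (hc.image (S.continuous_comp ξ m)).isClosed.mem_of_tendsto (hπ ξ) ?_
    filter_upwards [eventually_ge_atTop m] with n hn using hmem ξ m n hn

end CodingMap

/-! ### The product measure on branches -/

section BranchMeasure

variable {E : Type*} [PseudoMetricSpace E] {ι : ℕ → Type} (S : SimilaritySystem E ι)
  [∀ j, Fintype (ι j)]

/-- The sum of the `s`-th powers of the contraction rates at level `j`. -/
noncomputable def total (s : ℝ) (j : ℕ) : ℝ := ∑ i, S.ratio j i ^ s

lemma total_pos [∀ j, Nonempty (ι j)] (s : ℝ) (j : ℕ) : 0 < S.total s j :=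
  Finset.sum_pos (fun i _ => Real.rpow_pos_of_pos (S.ratio_pos j i) s) Finset.univ_nonempty

/-- Stopping levels at scale `ρ` are `O(log (1/ρ))`, so sublinear growth in the level becomes an
arbitrarily small power of `ρ`. -/
lemma exists_exp_abs_sum_le [∀ j, Nonempty (ι j)] {s : ℝ}
    (hgrow : ∀ ε : ℝ, 0 < ε → ∃ C : ℝ, ∀ m : ℕ,
      |∑ j ∈ Finset.range m, Real.log (S.total s j)| ≤ ε * m + C) {ε : ℝ} (hε : 0 < ε) :
    ∃ A : ℝ, 0 < A ∧ ∀ (ρ : ℝ) (m : ℕ), 0 < ρ →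
      (m : ℝ) * Real.log S.cmax⁻¹ ≤ Real.log S.cmax⁻¹ + Real.log ρ⁻¹ →
      Real.exp |∑ j ∈ Finset.range m, Real.log (S.total s j)| ≤ A * ρ ^ (-ε) := by
  have hmax : 0 < S.cmax := S.cmin_pos.trans_le
    ((S.cmin_le 0 (Classical.arbitrary _)).trans (S.le_cmax 0 _))
  have hlog : 0 < Real.log S.cmax⁻¹ := Real.log_pos ((one_lt_inv₀ hmax).2 S.cmax_lt_one)
  obtain ⟨C, hC⟩ := hgrow (ε * Real.log S.cmax⁻¹) (mul_pos hε hlog)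
  refine ⟨Real.exp (ε * Real.log S.cmax⁻¹ + C), Real.exp_pos _, fun ρ m hρ hm => ?_⟩
  rw [Real.rpow_def_of_pos hρ, ← Real.exp_add, Real.exp_le_exp]
  refine (hC m).trans ?_
  have := mul_le_mul_of_nonneg_left hm hε.le
  rw [Real.log_inv ρ] at this
  linarith

variable [∀ j, MeasurableSpace (ι j)]

/-- The probability measure on `ι j` with weights proportional to `ratio j i ^ s`. -/
noncomputable def levelMeasure (s : ℝ) (j : ℕ) : Measure (ι j) :=
  ∑ i, ENNReal.ofReal (S.ratio j i ^ s / S.total s j) • Measure.dirac i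

instance [∀ j, Nonempty (ι j)] (s : ℝ) (j : ℕ) : IsProbabilityMeasure (S.levelMeasure s j) := by
  constructor
  have h : ∀ i : ι j, 0 ≤ S.ratio j i ^ s / S.total s j := fun i =>
    div_nonneg (Real.rpow_nonneg (S.ratio_pos j i).le s) (S.total_pos s j).le
  simp only [levelMeasure, Measure.coe_finsetSum, Finset.sum_apply, Measure.smul_apply,
    measure_univ, smul_eq_mul, mul_one]
  rw [← ENNReal.ofReal_sum_of_nonneg fun i _ => h i, ← Finset.sum_div,
    ← total, div_self (S.total_pos s j).ne', ENNReal.ofReal_one]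

lemma levelMeasure_singleton [∀ j, MeasurableSingletonClass (ι j)] (s : ℝ) (j : ℕ) (i : ι j) :
    S.levelMeasure s j {i} = ENNReal.ofReal (S.ratio j i ^ s / S.total s j) := by
  classical
  simp [levelMeasure, Measure.coe_finsetSum, Finset.sum_apply,
    Set.indicator_apply]

/-- The product of the measures `levelMeasure`. -/
noncomputable def branchMeasure [∀ j, Nonempty (ι j)] (s : ℝ) : Measure (∀ j, ι j) :=
  Measure.infinitePi (S.levelMeasure s)

instance [∀ j, Nonempty (ι j)] (s : ℝ) : IsProbabilityMeasure (S.branchMeasure s) := by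
  unfold branchMeasure
  infer_instance

/-- The normalising constants are gathered in an exponential because the strong law controls the sum
of their logarithms. -/
lemma branchMeasure_cylinder [∀ j, MeasurableSingletonClass (ι j)] [∀ j, Nonempty (ι j)] (s : ℝ)
    (ξ : ∀ j, ι j) (m : ℕ) :
    S.branchMeasure s {η | ∀ j < m, η j = ξ j} = ENNReal.ofReal
      (S.rate ξ m ^ s * Real.exp (-∑ j ∈ Finset.range m, Real.log (S.total s j))) := by
  have hset : {η : ∀ j, ι j | ∀ j < m, η j = ξ j} =
      Set.pi (Finset.range m : Set ℕ) fun j => {ξ j} := by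
    ext η; simp [Set.mem_pi]
  rw [hset, branchMeasure, Measure.infinitePi_pi _ fun j _ => measurableSet_singleton _]
  simp_rw [levelMeasure_singleton]
  rw [← ENNReal.ofReal_prod_of_nonneg, Finset.prod_div_distrib,
    Real.finsetProd_rpow _ _ fun j _ => (S.ratio_pos j _).le, Real.exp_neg, Real.exp_sum,
    Finset.prod_congr rfl fun j _ => Real.exp_log (S.total_pos s j), rate, div_eq_mul_inv]
  exact fun j _ =>
    div_nonneg (Real.rpow_nonneg (S.ratio_pos j _).le s) (S.total_pos s j).le

end BranchMeasure

/-! ### Regularity of the projected measure under the open set condition -/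

section Regularity

variable {E : Type*} [NormedAddCommGroup E] [InnerProductSpace ℝ E] [FiniteDimensional ℝ E]
  {ι : ℕ → Type} (S : SimilaritySystem E ι)

/-- A set of diameter at most `ρ` meets boundedly many pieces of the attractor of size `ρ`. -/
lemma exists_encard_stopping_le {Δ O : Set E} (hΔ : Bornology.IsBounded Δ) (hO : IsOpen O)
    (hOS : ∀ j i, S.map j i '' O ⊆ O)
    (hdisj : ∀ j i i', (S.map j i '' O ∩ S.map j i' '' O).Nonempty → i = i') {a : E}
    (ha : a ∈ O) :
    ∃ M : ℕ, ∀ (ρ : ℝ) (U : Set E) (W : Set (∀ j, ι j)) (m : (∀ j, ι j) → ℕ), 0 < ρ →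
      Metric.ediam U ≤ ENNReal.ofReal ρ →
      (∀ ξ, S.cmin * ρ ≤ S.rate ξ (m ξ) ∧ S.rate ξ (m ξ) ≤ ρ ∧ ∀ j < m ξ, ρ < S.rate ξ j) →
      (∀ ξ ∈ W, (S.comp ξ (m ξ) '' Δ ∩ U).Nonempty) →
      ((fun ξ => S.comp ξ (m ξ) a) '' W).encard ≤ M := by
  obtain ⟨η, hη, hηO⟩ := Metric.isOpen_iff.1 hO a ha
  obtain ⟨K, hK, hΔK⟩ := hΔ.subset_closedBall_lt 0 a
  -- `K * ρ` is the distance from the image of `a` to its piece and `ρ` the diameter of `U`; a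
  -- stopped image of `O` contains a ball of radius `cmin * ρ * η` around the image of `a`.
  obtain ⟨M, hM⟩ := exists_encard_le_of_separated E (K := K + 1) (κ := S.cmin * η)
    (by linarith) (mul_pos S.cmin_pos hη)
  refine ⟨M, fun ρ U W m hρ hU hm hW => ?_⟩
  rcases W.eq_empty_or_nonempty with rfl | ⟨ξ₀, hξ₀⟩
  · simp
  obtain ⟨x, -, hxU⟩ := hW ξ₀ hξ₀
  refine hM ρ x _ hρ ?_ ?_
  · rintro _ ⟨ξ, hξ, rfl⟩
    obtain ⟨_, ⟨y, hy, rfl⟩, hyU⟩ := hW ξ hξ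
    have h1 : dist (S.comp ξ (m ξ) a) (S.comp ξ (m ξ) y) ≤ ρ * K := by
      rw [S.dist_comp]
      have := Metric.mem_closedBall'.1 (hΔK hy)
      exact mul_le_mul (hm ξ).2.1 this dist_nonneg hρ.le
    have h2 : dist (S.comp ξ (m ξ) y) x ≤ ρ := by
      have := (Metric.edist_le_ediam_of_mem hyU hxU).trans hU
      rwa [edist_dist, ENNReal.ofReal_le_ofReal_iff hρ.le] at this
    rw [Metric.mem_closedBall]
    have := dist_triangle (S.comp ξ (m ξ) a) (S.comp ξ (m ξ) y) x
    show dist (S.comp ξ (m ξ) a) x ≤ _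
    linarith
  · rintro _ ⟨ξ, -, rfl⟩ _ ⟨ξ', -, rfl⟩ hne
    dsimp only at hne ⊢
    have hsep : ∃ j, j < m ξ ∧ j < m ξ' ∧ ξ j ≠ ξ' j := by
      by_contra! hcon
      have heq := S.stopping_eq (hm ξ).2.1 (hm ξ').2.1 (hm ξ).2.2 (hm ξ').2.2 hcon
      refine hne ?_
      rw [← heq, S.comp_congr fun j hj => hcon j hj (heq ▸ hj)]
    have hd := S.disjoint_image_comp hOS hdisj S.comp_injective hsep
    by_contra! hlt
    have hball : S.comp ξ' (m ξ') a ∈ S.comp ξ (m ξ) '' Metric.ball a η := by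
      rw [image_ball_of_dist_eq (S.rate_pos ξ (m ξ)) (S.dist_comp ξ (m ξ)), Metric.mem_ball']
      refine hlt.trans_le ?_
      have := mul_le_mul_of_nonneg_right (hm ξ).1 hη.le
      linarith
    exact disjoint_left.1 hd (image_mono hηO hball) (mem_image_of_mem _ ha)

variable [∀ j, Fintype (ι j)] [∀ j, MeasurableSpace (ι j)] [∀ j, MeasurableSingletonClass (ι j)]
  [∀ j, Nonempty (ι j)] [MeasurableSpace E] [BorelSpace E]

lemma isAlmostRegular_map {Δ O : Set E} (hΔc : IsCompact Δ) (hΔ : ∀ j i, S.map j i '' Δ ⊆ Δ)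
    (hO : IsOpen O) (hOne : O.Nonempty) (hOS : ∀ j i, S.map j i '' O ⊆ O)
    (hdisj : ∀ j i i', (S.map j i '' O ∩ S.map j i' '' O).Nonempty → i = i')
    {s : ℝ} (hs : 0 < s) (hgrow : ∀ ε : ℝ, 0 < ε → ∃ C : ℝ, ∀ m : ℕ,
      |∑ j ∈ Finset.range m, Real.log (S.total s j)| ≤ ε * m + C)
    {π : (∀ j, ι j) → E} (hπm : Measurable π) (hπ : ∀ ξ m, π ξ ∈ S.comp ξ m '' Δ) :
    IsAlmostRegular ((S.branchMeasure s).map π) (S.limitSet Δ) s := by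
  constructor
  · intro ε hε
    obtain ⟨A, hA, hexp⟩ := S.exists_exp_abs_sum_le hgrow hε
    have hcmin := S.cmin_pos
    -- The summand `1` makes stopped pieces of scale `r / D` fit strictly into an open `r`-ball,
    -- also when `Δ` is a point.
    set D := Metric.diam Δ + 1 with hD
    have hD1 : 1 ≤ D := by linarith [Metric.diam_nonneg (s := Δ)]
    refine ⟨S.cmin ^ s * A⁻¹ * D ^ (-(s + ε)), by positivity, fun x hx r hr hr1 => ?_⟩
    have hρ : 0 < r / D := by positivity
    have hρ1 : r / D ≤ 1 := by rw [div_le_one (by positivity)]; linarith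
    -- By level `n + 1` every branch has stopped, so a branch whose piece at that level contains `x`
    -- is enough; it may depend on the scale.
    obtain ⟨n, hn⟩ := exists_pow_lt_of_lt_one hρ S.cmax_lt_one
    obtain ⟨ξ, hξ⟩ := mem_iUnion.1 (mem_iInter₂.1 hx (n + 1) (by omega))
    obtain ⟨m, hm1, hm2, hm3, hm4⟩ := S.exists_stopping ξ hρ hρ1
    have hmn : m ≤ n + 1 := by
      by_contra! hlt
      exact absurd (hm3 n (by omega)) (not_lt.2 ((S.rate_le_pow ξ n).trans hn.le))
    obtain ⟨y, hy, rfl⟩ := S.image_comp_subset hΔ ξ hmn hξ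
    have hsub : {η : ∀ j, ι j | ∀ j < m, η j = ξ j} ⊆
        π ⁻¹' Metric.ball (S.comp ξ m y) r := by
      intro η hη
      obtain ⟨z, hz, hzη⟩ := hπ η m
      rw [mem_preimage, ← hzη, S.comp_congr hη, Metric.mem_ball, S.dist_comp]
      calc S.rate ξ m * dist z y ≤ r / D * Metric.diam Δ := by
            gcongr
            exact Metric.dist_le_diam_of_mem hΔc.isBounded hz hy
        _ < r / D * D := by gcongr; linarith
        _ = r := by field_simp
    rw [Measure.map_apply hπm Metric.isOpen_ball.measurableSet]
    refine le_trans ?_ (measure_mono hsub)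
    rw [S.branchMeasure_cylinder]
    refine ENNReal.ofReal_le_ofReal ?_
    have hE : A⁻¹ * (r / D) ^ ε ≤
        Real.exp (-∑ j ∈ Finset.range m, Real.log (S.total s j)) := by
      have h1 : (Real.exp |∑ j ∈ Finset.range m, Real.log (S.total s j)|)⁻¹ ≤
          Real.exp (-∑ j ∈ Finset.range m, Real.log (S.total s j)) := by
        rw [← Real.exp_neg, Real.exp_le_exp]
        exact neg_le_neg (le_abs_self _)
      refine le_trans ?_ h1
      have h2 := inv_anti₀ (Real.exp_pos _) (hexp _ m hρ hm4)
      rwa [mul_inv, ← Real.rpow_neg hρ.le, neg_neg] at h2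
    calc S.cmin ^ s * A⁻¹ * D ^ (-(s + ε)) * r ^ (s + ε)
        = (S.cmin * (r / D)) ^ s * (A⁻¹ * (r / D) ^ ε) := by
          rw [Real.mul_rpow hcmin.le hρ.le, Real.rpow_neg (by positivity)]
          have : (r / D) ^ s * (r / D) ^ ε = r ^ (s + ε) * (D ^ (s + ε))⁻¹ := by
            rw [← Real.rpow_add hρ, Real.div_rpow hr.le (by positivity), div_eq_mul_inv]
          linear_combination -(S.cmin ^ s * A⁻¹) * this
      _ ≤ _ := by
          gcongr
          exact Real.rpow_nonneg (S.rate_pos ξ m).le s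
  · intro ε hε hεs
    obtain ⟨A, hA, hexp⟩ := S.exists_exp_abs_sum_le hgrow hε
    obtain ⟨a, ha⟩ := hOne
    obtain ⟨M, hM⟩ := S.exists_encard_stopping_le hΔc.isBounded hO hOS hdisj ha
    refine ⟨M * A + 1, by positivity, fun U ρ hρ hU => ?_⟩
    rcases lt_or_ge 1 ρ with h1ρ | hρ1
    -- For `ρ > 1` the total mass `1` is already small enough; this is what the `+ 1` in the
    -- constant is for.
    · have : IsProbabilityMeasure ((S.branchMeasure s).map π) :=
        Measure.isProbabilityMeasure_map hπm.aemeasurable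
      refine prob_le_one.trans ?_
      rw [← ENNReal.ofReal_one]
      refine ENNReal.ofReal_le_ofReal ?_
      have h1 : 1 ≤ ρ ^ (s - ε) := Real.one_le_rpow h1ρ.le (by linarith)
      have h2 : 0 ≤ (M : ℝ) * A := by positivity
      nlinarith
    choose m hm1 hm2 hm3 hm4 using fun ξ => S.exists_stopping ξ hρ hρ1
    -- Closing `U` makes it measurable without changing its diameter.
    set W := π ⁻¹' closure U with hW
    set z : (∀ j, ι j) → E := fun ξ => S.comp ξ (m ξ) a with hz
    have hcard : (z '' W).encard ≤ M := by
      refine hM ρ (closure U) W m hρ (by rwa [Metric.ediam_closure])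
        (fun ξ => ⟨hm1 ξ, hm2 ξ, hm3 ξ⟩) fun ξ hξ => ⟨π ξ, hπ ξ _, hξ⟩
    have hfin : (z '' W).Finite := Set.finite_of_encard_le_coe hcard
    have hex : ∀ p : z '' W, ∃ ξ ∈ W, z ξ = p := fun p => p.2
    choose rep hrepW hrep using hex
    -- Branches in different stopped cylinders send `O` to disjoint sets, so the point `z ξ`
    -- determines the cylinder and one representative per point suffices.
    have hcover : W ⊆ ⋃ p : z '' W, {η | ∀ j < m (rep p), η j = rep p j} := by
      intro ξ hξ
      refine mem_iUnion.2 ⟨⟨z ξ, mem_image_of_mem _ hξ⟩, ?_⟩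
      set p : z '' W := ⟨z ξ, mem_image_of_mem _ hξ⟩
      by_contra hcon
      have hsep : ∃ j, j < m ξ ∧ j < m (rep p) ∧ ξ j ≠ rep p j := by
        by_contra! hagree
        have heq := S.stopping_eq (hm2 ξ) (hm2 (rep p)) (hm3 ξ) (hm3 (rep p)) hagree
        exact hcon fun j hj => hagree j (heq ▸ hj) hj
      have hd := S.disjoint_image_comp hOS hdisj S.comp_injective hsep
      exact disjoint_left.1 hd (mem_image_of_mem _ ha)
        ⟨a, ha, hrep p⟩
    have : Countable (z '' W) := hfin.countable
    calc (S.branchMeasure s).map π U ≤ (S.branchMeasure s).map π (closure U) :=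
          measure_mono subset_closure
      _ = S.branchMeasure s W := Measure.map_apply hπm isClosed_closure.measurableSet
      _ ≤ ∑' p : z '' W, S.branchMeasure s {η | ∀ j < m (rep p), η j = rep p j} :=
          (measure_mono hcover).trans (measure_iUnion_le _)
      _ ≤ ∑' _ : z '' W, ENNReal.ofReal (A * ρ ^ (s - ε)) := by
          refine ENNReal.tsum_le_tsum fun p => ?_
          rw [S.branchMeasure_cylinder]
          refine ENNReal.ofReal_le_ofReal ?_
          have hE : Real.exp (-∑ j ∈ Finset.range (m (rep p)), Real.log (S.total s j)) ≤
              A * ρ ^ (-ε) :=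
            (Real.exp_le_exp.2 (neg_le_abs _)).trans (hexp ρ _ hρ (hm4 _))
          calc _ ≤ ρ ^ s * (A * ρ ^ (-ε)) := by
                gcongr
                · exact (S.rate_pos _ _).le
                · exact hm2 _
            _ = A * ρ ^ (s - ε) := by
                rw [sub_eq_add_neg, Real.rpow_add hρ]; ring
      _ = (z '' W).encard * ENNReal.ofReal (A * ρ ^ (s - ε)) := by rw [ENNReal.tsum_set_const]
      _ ≤ (M : ℝ≥0∞) * ENNReal.ofReal (A * ρ ^ (s - ε)) := by
          gcongr
          exact_mod_cast ENat.toENNReal_le.2 hcard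
      _ ≤ ENNReal.ofReal ((M * A + 1) * ρ ^ (s - ε)) := by
          rw [← ENNReal.ofReal_natCast, ← ENNReal.ofReal_mul (by positivity)]
          refine ENNReal.ofReal_le_ofReal ?_
          have : 0 ≤ ρ ^ (s - ε) := by positivity
          linarith

theorem isQuasiAssouadDim_limitSet {Δ O : Set E} (hΔc : IsCompact Δ) (hΔne : Δ.Nonempty)
    (hΔ : ∀ j i, S.map j i '' Δ ⊆ Δ)
    (hO : IsOpen O) (hOne : O.Nonempty) (hOS : ∀ j i, S.map j i '' O ⊆ O)
    (hdisj : ∀ j i i', (S.map j i '' O ∩ S.map j i' '' O).Nonempty → i = i')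
    {s : ℝ} (hs : 0 < s) (hgrow : ∀ ε : ℝ, 0 < ε → ∃ C : ℝ, ∀ m : ℕ,
      |∑ j ∈ Finset.range m, Real.log (S.total s j)| ≤ ε * m + C) :
    IsQuasiAssouadDim (S.limitSet Δ) (dimH (S.limitSet Δ)) := by
  have := FiniteDimensional.proper ℝ E
  obtain ⟨π, hπm, hπ⟩ := S.exists_measurable_codingMap hΔc hΔne hΔ
  have hreg := S.isAlmostRegular_map hΔc hΔ hO hOne hOS hdisj hs hgrow hπm hπ
  refine hreg.isQuasiAssouadDim hs ?_ ?_
  -- Only an inequality is needed here, so measurability of the limit set is not an issue.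
  · have h1 := Measure.le_map_apply hπm.aemeasurable (μ := S.branchMeasure s) (S.limitSet Δ)
    have h2 : π ⁻¹' S.limitSet Δ = univ := eq_univ_of_forall fun ξ =>
      mem_iInter₂.2 fun n _ => mem_iUnion.2 ⟨ξ, hπ ξ n⟩
    rw [h2, measure_univ] at h1
    exact (one_pos.trans_le h1).ne'
  · refine hΔc.isBounded.subset fun x hx => ?_
    obtain ⟨ξ, hξ⟩ := mem_iUnion.1 (mem_iInter₂.1 hx 1 le_rfl)
    obtain ⟨y, hy, rfl⟩ := S.image_comp_subset hΔ ξ (Nat.zero_le 1) hξ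
    exact hy

end Regularity

end SimilaritySystem

lemma exists_abs_le_mul_add_of_tendsto {u : ℕ → ℝ}
    (hu : Tendsto (fun n : ℕ => u n / n) atTop (𝓝 0)) {ε : ℝ} (hε : 0 < ε) :
    ∃ C : ℝ, ∀ m : ℕ, |u m| ≤ ε * m + C := by
  obtain ⟨N, hN⟩ := eventually_atTop.1 ((tendsto_order.1 (hu.abs)).2 ε (by simpa using hε))
  -- The range always contains `0`, where `u 0 / 0 = 0` says nothing about `u 0`.
  refine ⟨∑ n ∈ Finset.range (N + 1), |u n|, fun m => ?_⟩
  have hsum : 0 ≤ ∑ n ∈ Finset.range (N + 1), |u n| := Finset.sum_nonneg fun n _ => abs_nonneg _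
  by_cases hm : m < N + 1
  · have h1 : |u m| ≤ ∑ n ∈ Finset.range (N + 1), |u n| :=
      Finset.single_le_sum (f := fun n => |u n|) (fun n _ => abs_nonneg _) (Finset.mem_range.2 hm)
    have h2 : 0 ≤ ε * m := by positivity
    linarith
  · have h1 := (hN m (by omega)).le
    have hm0 : (0 : ℝ) < m := by exact_mod_cast (by omega : 0 < m)
    rw [abs_div, Nat.abs_cast, div_le_iff₀ hm0] at h1
    linarith

/-! ### Random homogeneous systems -/

namespace RIFS

variable {k d : ℕ} {L : RIFS k d}

/-- The indices of the maps of the iterated function system `l`. -/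
abbrev Branch (l : L.Λ) : Type := {i : Fin L.maxMaps // (i : ℕ) < L.numMaps l}

lemma nonempty_branch {l : L.Λ} (hl : L.numMaps l ≠ 0) : Nonempty (Branch l) :=
  ⟨⟨⟨0, (Nat.pos_of_ne_zero hl).trans_le (L.numMaps_le l)⟩, Nat.pos_of_ne_zero hl⟩⟩

/-- The non-autonomous iterated function system that uses the system `ω j` at level `j`. -/
def system {cmin cmax : ℝ} (h0 : 0 < cmin) (h1 : cmax < 1)
    (hc : ∀ (l : L.Λ) (i : Fin L.maxMaps), (i : ℕ) < L.numMaps l →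
      cmin ≤ L.ratio l i ∧ L.ratio l i ≤ cmax) (ω : ℕ → L.Λ) :
    SimilaritySystem (EuclideanSpace ℝ (Fin d)) fun j => Branch (ω j) where
  map j i := L.map (ω j) i
  ratio j i := L.ratio (ω j) i
  cmin := cmin
  cmax := cmax
  cmin_pos := h0
  cmax_lt_one := h1
  cmin_le _ i := (hc _ _ i.2).1
  le_cmax _ i := (hc _ _ i.2).2
  dist_map _ i := L.dist_map _ _ i.2

/-- The subtree at a child of a homogeneous labelling is homogeneous for the shifted sequence, hence
the induction over all `ω`. -/
lemma coding_homogeneous (ω : ℕ → L.Λ) (v : L.Node) (e : List L.Letter) :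
    coding (fun w => ω w.length) v = some e ↔
      (∀ j : Fin v.length, (v[j] : ℕ) < L.numMaps (ω j)) ∧
        e = List.ofFn fun j : Fin v.length => (ω j, v[j]) := by
  induction v generalizing ω e with
  | nil => simp [coding, eq_comm]
  | cons i v ih =>
    have ih' := ih (fun n => ω (n + 1))
    simp only [coding, List.length_nil, List.length_cons, letter]
    rw [Option.map₂_eq_some_iff]
    constructor
    · rintro ⟨a, b, ha, hb, rfl⟩
      obtain ⟨hb1, rfl⟩ := (ih' b).1 hb
      rw [Option.mem_def, Option.ite_none_right_eq_some] at ha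
      obtain ⟨hi, ha⟩ := ha
      cases ha
      refine ⟨fun j => ?_, ?_⟩
      · refine Fin.cases ?_ (fun j => ?_) j
        · simpa using hi
        · simpa using hb1 j
      · rw [List.ofFn_succ]
        simp
    · rintro ⟨h1, rfl⟩
      have hi : (i : ℕ) < L.numMaps (ω 0) := by simpa using h1 0
      refine ⟨(ω 0, i), _, if_pos hi, (ih' _).2 ⟨fun j => by simpa using h1 j.succ, rfl⟩, ?_⟩
      rw [List.ofFn_succ]
      simp

lemma codingMap_append (e e' : List L.Letter) :
    codingMap (e ++ e') = codingMap e ∘ codingMap e' := by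
  induction e with
  | nil => rfl
  | cons a e ih => rw [List.cons_append, codingMap, codingMap, ih, Function.comp_assoc]

lemma codingMap_ofFn {cmin cmax : ℝ} (h0 : 0 < cmin) (h1 : cmax < 1)
    (hc : ∀ (l : L.Λ) (i : Fin L.maxMaps), (i : ℕ) < L.numMaps l →
      cmin ≤ L.ratio l i ∧ L.ratio l i ≤ cmax) (ω : ℕ → L.Λ) (ξ : ∀ j, Branch (ω j)) (n : ℕ) :
    codingMap (List.ofFn fun j : Fin n => ((ω j, (ξ j : Fin L.maxMaps)) : L.Letter)) =
      (system h0 h1 hc ω).comp ξ n := by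
  induction n with
  | zero => simp [codingMap, SimilaritySystem.comp]
  | succ n ih =>
    rw [List.ofFn_succ', List.concat_eq_append, codingMap_append, SimilaritySystem.comp, ← ih]
    rfl

lemma attractor_homogeneous {cmin cmax : ℝ} (h0 : 0 < cmin) (h1 : cmax < 1)
    (hc : ∀ (l : L.Λ) (i : Fin L.maxMaps), (i : ℕ) < L.numMaps l →
      cmin ≤ L.ratio l i ∧ L.ratio l i ≤ cmax) {ω : ℕ → L.Λ} (hω : ∀ j, L.numMaps (ω j) ≠ 0)
    (Δ : Set (EuclideanSpace ℝ (Fin d))) :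
    attractor Δ (fun v : L.Node => ω v.length) = (system h0 h1 hc ω).limitSet Δ := by
  have := fun j => nonempty_branch (hω j)
  refine iInter_congr fun n => iInter_congr fun _ => Subset.antisymm ?_ ?_
  · refine iUnion₂_subset fun e he => ?_
    obtain ⟨v, rfl, hv⟩ := he
    obtain ⟨hv1, rfl⟩ := (coding_homogeneous ω v e).1 hv
    -- A finite node extends to an infinite branch because no level is empty.
    let ξ : ∀ j, Branch (ω j) := fun j =>
      if h : j < v.length then ⟨v[j], hv1 ⟨j, h⟩⟩ else Classical.arbitrary _
    refine subset_iUnion_of_subset ξ ?_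
    rw [← codingMap_ofFn]
    have hξ : ∀ j : Fin v.length, ((ξ j : Branch (ω j)) : Fin L.maxMaps) = v[j] := fun j => by
      simp [ξ]
    simp_rw [hξ]
    rfl
  · refine iUnion_subset fun ξ => ?_
    rw [← codingMap_ofFn]
    refine subset_iUnion₂_of_subset _ ⟨List.ofFn fun j : Fin n => (ξ j : Fin L.maxMaps),
      List.length_ofFn, (coding_homogeneous ω _ _).2 ⟨fun j => ?_, ?_⟩⟩ Subset.rfl
    · simpa using (ξ j).2
    · refine List.ext_getElem (by simp) fun j _ _ => by simp

/-! ### The critical exponent -/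

variable (L)

/-- The sum of the `t`-th powers of the contraction rates of the system `l`. -/
noncomputable def total (t : ℝ) (l : L.Λ) : ℝ :=
  ∑ i : Fin L.maxMaps, if (i : ℕ) < L.numMaps l then L.ratio l i ^ t else 0

lemma measurable_total (t : ℝ) : Measurable (L.total t) := by
  refine Finset.measurable_sum _ fun i _ => ?_
  -- Only the truncated ratio is assumed measurable, so the power is rewritten in terms of it.
  have h : (fun l => if (i : ℕ) < L.numMaps l then L.ratio l i ^ t else 0) = fun l =>
      if (i : ℕ) < L.numMaps l then (if (i : ℕ) < L.numMaps l then L.ratio l i else 0) ^ t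
      else 0 := by
    ext l
    split_ifs <;> rfl
  rw [h]
  exact Measurable.ite (measurableSet_lt measurable_const L.measurable_numMaps)
    ((L.measurable_ratio i).pow_const t) measurable_const

lemma total_eq_sum_branch (t : ℝ) (l : L.Λ) :
    L.total t l = ∑ i : Branch l, L.ratio l i ^ t := by
  rw [total, ← Finset.sum_filter]
  exact Finset.sum_subtype _ (by simp) _

lemma card_branch (l : L.Λ) : Fintype.card (Branch l) = L.numMaps l := by
  rw [Fintype.card_congr (⟨fun i => ⟨i.1, i.2⟩,
    fun i => ⟨⟨i, i.2.trans_le (L.numMaps_le l)⟩, i.2⟩, fun _ => rfl, fun _ => rfl⟩ :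
      Branch l ≃ Fin (L.numMaps l)), Fintype.card_fin]

lemma total_zero (l : L.Λ) : L.total 0 l = L.numMaps l := by
  simp [total_eq_sum_branch, ← L.card_branch l]

variable {L} {cmin cmax : ℝ}

lemma rpow_cmin_le_total (h0 : 0 < cmin)
    (hc : ∀ (l : L.Λ) (i : Fin L.maxMaps), (i : ℕ) < L.numMaps l →
      cmin ≤ L.ratio l i ∧ L.ratio l i ≤ cmax) {t : ℝ} (ht : 0 ≤ t) {l : L.Λ}
    (hl : L.numMaps l ≠ 0) : cmin ^ t ≤ L.total t l := by
  obtain ⟨i⟩ := nonempty_branch hl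
  rw [total_eq_sum_branch]
  refine le_trans ?_ (Finset.single_le_sum (f := fun i : Branch l => L.ratio l i ^ t)
    (fun j _ => Real.rpow_nonneg (h0.le.trans (hc l j j.2).1) t) (Finset.mem_univ i))
  exact Real.rpow_le_rpow h0.le (hc l i i.2).1 ht

lemma total_le (h0 : 0 < cmin)
    (hc : ∀ (l : L.Λ) (i : Fin L.maxMaps), (i : ℕ) < L.numMaps l →
      cmin ≤ L.ratio l i ∧ L.ratio l i ≤ cmax) (hmax : 0 ≤ cmax) {t : ℝ} (ht : 0 ≤ t) (l : L.Λ) :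
    L.total t l ≤ L.maxMaps * cmax ^ t := by
  calc L.total t l ≤ ∑ _i : Fin L.maxMaps, cmax ^ t := by
        refine Finset.sum_le_sum fun i _ => ?_
        split_ifs with hi
        · exact Real.rpow_le_rpow (h0.le.trans (hc l i hi).1) (hc l i hi).2 ht
        · exact Real.rpow_nonneg hmax t
    _ = L.maxMaps * cmax ^ t := by simp

lemma log_total_bounds (h0 : 0 < cmin) (h01 : cmin ≤ cmax)
    (hc : ∀ (l : L.Λ) (i : Fin L.maxMaps), (i : ℕ) < L.numMaps l →
      cmin ≤ L.ratio l i ∧ L.ratio l i ≤ cmax) {t : ℝ} (ht : 0 ≤ t) {l : L.Λ}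
    (hl : L.numMaps l ≠ 0) :
    t * Real.log cmin ≤ Real.log (L.total t l) ∧
      Real.log (L.total t l) ≤ Real.log L.maxMaps + t * Real.log cmax := by
  have hmax : 0 < cmax := h0.trans_le h01
  have hN : (0 : ℝ) < L.maxMaps := by
    exact_mod_cast (Nat.pos_of_ne_zero hl).trans_le (L.numMaps_le l)
  have hlow := rpow_cmin_le_total h0 hc ht hl
  have hpos : 0 < cmin ^ t := Real.rpow_pos_of_pos h0 t
  constructor
  · rw [← Real.log_rpow h0]
    exact Real.log_le_log hpos hlow
  · rw [← Real.log_rpow hmax, ← Real.log_mul hN.ne' (Real.rpow_pos_of_pos hmax t).ne']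
    exact Real.log_le_log (hpos.trans_le hlow) (total_le h0 hc hmax.le ht l)

lemma ae_numMaps_ne_zero (hzero : L.μ {l | (l : EuclideanSpace ℝ (Fin k)) = 0} = 0) :
    ∀ᵐ l ∂L.μ, L.numMaps l ≠ 0 := by
  rw [ae_iff]
  simpa [L.numMaps_eq_zero_iff] using hzero

/-- Uniformity in `t ∈ [0, T]` supplies the dominating constant for continuity of the integral in
`t`. -/
lemma ae_abs_log_total_le (h0 : 0 < cmin) (h01 : cmin ≤ cmax) (h1 : cmax < 1)
    (hc : ∀ (l : L.Λ) (i : Fin L.maxMaps), (i : ℕ) < L.numMaps l →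
      cmin ≤ L.ratio l i ∧ L.ratio l i ≤ cmax)
    (hzero : L.μ {l | (l : EuclideanSpace ℝ (Fin k)) = 0} = 0) {t T : ℝ} (ht : 0 ≤ t)
    (htT : t ≤ T) :
    ∀ᵐ l ∂L.μ, ‖Real.log (L.total t l)‖ ≤ T * -Real.log cmin + Real.log L.maxMaps := by
  filter_upwards [ae_numMaps_ne_zero hzero] with l hl
  obtain ⟨h2, h3⟩ := log_total_bounds h0 h01 hc ht hl
  have hlmin : Real.log cmin < 0 := Real.log_neg h0 (h01.trans_lt h1)
  have hlmax : Real.log cmax < 0 := Real.log_neg (h0.trans_le h01) h1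
  have hN : 0 ≤ Real.log L.maxMaps := Real.log_natCast_nonneg _
  have h4 : t * -Real.log cmin ≤ T * -Real.log cmin := by gcongr; linarith
  have h5 : t * Real.log cmax ≤ 0 := mul_nonpos_of_nonneg_of_nonpos ht hlmax.le
  have h6 : 0 ≤ t * -Real.log cmin := mul_nonneg ht (by linarith)
  rw [Real.norm_eq_abs, abs_le]
  constructor <;> linarith

lemma integrable_log_total (h0 : 0 < cmin) (h01 : cmin ≤ cmax) (h1 : cmax < 1)
    (hc : ∀ (l : L.Λ) (i : Fin L.maxMaps), (i : ℕ) < L.numMaps l →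
      cmin ≤ L.ratio l i ∧ L.ratio l i ≤ cmax)
    (hzero : L.μ {l | (l : EuclideanSpace ℝ (Fin k)) = 0} = 0) {t : ℝ} (ht : 0 ≤ t) :
    Integrable (fun l => Real.log (L.total t l)) L.μ := by
  have := L.isProbabilityMeasure_μ
  exact Integrable.of_bound (Real.measurable_log.comp (L.measurable_total t)).aestronglyMeasurable
    _ (ae_abs_log_total_le h0 h01 h1 hc hzero ht le_rfl)

/-- The integrand is the logarithm of the number of maps, hence nonnegative; a vanishing integral
would force exactly one map almost surely, so mean `1`. -/
lemma integral_log_total_zero_pos (hne : L.NonExtinguishing)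
    (hzero : L.μ {l | (l : EuclideanSpace ℝ (Fin k)) = 0} = 0)
    (hint : Integrable (fun l => Real.log (L.total 0 l)) L.μ) :
    0 < ∫ l, Real.log (L.total 0 l) ∂L.μ := by
  have := L.isProbabilityMeasure_μ
  have hnn : 0 ≤ fun l => Real.log (L.total 0 l) := fun l => by
    simp only [total_zero]
    exact Real.log_natCast_nonneg _
  refine lt_of_le_of_ne (integral_nonneg hnn) fun h => ?_
  have hae := (integral_eq_zero_iff_of_nonneg hnn hint).1 h.symm
  have hone : ∀ᵐ l ∂L.μ, (L.numMaps l : ℝ) = 1 := by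
    filter_upwards [hae, ae_numMaps_ne_zero hzero] with l hl hl0
    simp only [total_zero, Pi.zero_apply, Real.log_eq_zero] at hl
    rcases hl with hl | hl | hl
    · exact absurd (by exact_mod_cast hl) hl0
    · exact hl
    · linarith [(L.numMaps l).cast_nonneg (α := ℝ)]
  have h2 : ∫ l, (L.numMaps l : ℝ) ∂L.μ = 1 := by
    rw [integral_congr_ae hone]
    simp
  unfold NonExtinguishing at hne
  linarith

/-- There is a positive exponent with vanishing expected logarithmic growth. -/
lemma exists_integral_log_total_eq_zero (h0 : 0 < cmin) (h01 : cmin ≤ cmax) (h1 : cmax < 1)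
    (hc : ∀ (l : L.Λ) (i : Fin L.maxMaps), (i : ℕ) < L.numMaps l →
      cmin ≤ L.ratio l i ∧ L.ratio l i ≤ cmax) (hne : L.NonExtinguishing)
    (hzero : L.μ {l | (l : EuclideanSpace ℝ (Fin k)) = 0} = 0) :
    ∃ s : ℝ, 0 < s ∧ ∫ l, Real.log (L.total s l) ∂L.μ = 0 := by
  have := L.isProbabilityMeasure_μ
  have hlmax : Real.log cmax < 0 := Real.log_neg (h0.trans_le h01) h1
  have hN : 0 ≤ Real.log L.maxMaps := Real.log_natCast_nonneg _
  -- At this exponent `maxMaps * cmax ^ T = 1`, so the logarithm is almost surely nonpositive.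
  set T := Real.log L.maxMaps / -Real.log cmax with hT
  have hT0 : 0 ≤ T := div_nonneg hN (by linarith)
  have hTeq : Real.log L.maxMaps + T * Real.log cmax = 0 := by
    rw [hT, div_neg, neg_mul, div_mul_cancel₀ _ hlmax.ne, add_neg_cancel]
  have hcont : ContinuousOn (fun t => ∫ l, Real.log (L.total t l) ∂L.μ) (Icc 0 T) := by
    refine continuousOn_of_dominated
      (bound := fun _ => T * -Real.log cmin + Real.log L.maxMaps)
      (fun t _ => (Real.measurable_log.comp (L.measurable_total t)).aestronglyMeasurable)
      (fun t ht => ae_abs_log_total_le h0 h01 h1 hc hzero ht.1 ht.2) (integrable_const _) ?_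
    filter_upwards [ae_numMaps_ne_zero hzero] with l hl
    refine ContinuousOn.log ?_ fun t ht =>
      ((Real.rpow_pos_of_pos h0 t).trans_le (rpow_cmin_le_total h0 hc ht.1 hl)).ne'
    simp_rw [total_eq_sum_branch]
    refine (continuous_finsetSum _ fun i _ => ?_).continuousOn
    exact Real.continuous_const_rpow (h0.trans_le (hc l i i.2).1).ne'
  have hpos := integral_log_total_zero_pos hne hzero
    (integrable_log_total h0 h01 h1 hc hzero le_rfl)
  have hneg : ∫ l, Real.log (L.total T l) ∂L.μ ≤ 0 := by
    refine integral_nonpos_of_ae ?_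
    filter_upwards [ae_numMaps_ne_zero hzero] with l hl
    exact (log_total_bounds h0 h01 hc hT0 hl).2.trans hTeq.le
  obtain ⟨s, hs, hs0⟩ := intermediate_value_Icc' hT0 hcont ⟨hneg, hpos.le⟩
  refine ⟨s, lt_of_le_of_ne hs.1 ?_, hs0⟩
  rintro rfl
  exact hpos.ne' hs0

/-! ### The strong law and transfer to random labellings -/

lemma ae_tendsto_sum_log_total {s : ℝ}
    (hint : Integrable (fun l => Real.log (L.total s l)) L.μ) :
    haveI := L.isProbabilityMeasure_μ
    ∀ᵐ ω ∂(Measure.infinitePi fun _ : ℕ => L.μ), Tendsto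
      (fun n : ℕ => (∑ j ∈ Finset.range n, Real.log (L.total s (ω j))) / n) atTop
      (𝓝 (∫ l, Real.log (L.total s l) ∂L.μ)) := by
  have := L.isProbabilityMeasure_μ
  have hm : Measurable fun l => Real.log (L.total s l) :=
    Real.measurable_log.comp (L.measurable_total s)
  have hmp : ∀ j, MeasurePreserving (Function.eval j) (Measure.infinitePi fun _ : ℕ => L.μ) L.μ :=
    fun j => measurePreserving_eval_infinitePi _ j
  have hslln := ProbabilityTheory.strong_law_ae_real
    (μ := Measure.infinitePi fun _ : ℕ => L.μ) (fun j ω => Real.log (L.total s (ω j)))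
    ((hmp 0).integrable_comp_of_integrable hint)
    (fun i j hij => (ProbabilityTheory.iIndepFun_infinitePi
      (X := fun _ l => Real.log (L.total s l)) fun _ => hm).indepFun hij)
    (fun j => ⟨(hm.comp (measurable_pi_apply j)).aemeasurable,
      (hm.comp (measurable_pi_apply 0)).aemeasurable, ?_⟩)
  · have h := integral_map (μ := Measure.infinitePi fun _ : ℕ => L.μ) (φ := Function.eval 0)
      (measurable_pi_apply 0).aemeasurable (f := fun l => Real.log (L.total s l))
      hm.aestronglyMeasurable
    rw [(hmp 0).map_eq] at h
    rw [h]
    exact hslln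
  · have h : ∀ j, Measure.map (fun ω : ℕ → L.Λ => Real.log (L.total s (ω j)))
        (Measure.infinitePi fun _ : ℕ => L.μ) = L.μ.map fun l => Real.log (L.total s l) := by
      intro j
      conv_rhs => rw [← (hmp j).map_eq, Measure.map_map hm (measurable_pi_apply j)]
      rfl
    rw [h, h]

/-- A property of homogeneous labellings that holds almost surely for independent level labels
holds almost surely for the random homogeneous measure. -/
lemma ae_homogeneousMeasure (hN : 0 < L.maxMaps) {p : L.Labelling → Prop}
    (hp : haveI := L.isProbabilityMeasure_μ
      ∀ᵐ ω ∂(Measure.infinitePi fun _ : ℕ => L.μ), p fun v => ω v.length) :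
    ∀ᵐ τ ∂L.homogeneousMeasure, p τ := by
  have := L.isProbabilityMeasure_μ
  obtain ⟨G, hG, hGm, hGp⟩ := hp.exists_measurable_mem
  -- The leftmost path recovers the level labels. Since `p` need not define a measurable set, it is
  -- replaced by a measurable event: the labelling is homogeneous and its spine lies in `G`.
  let spine : ℕ → L.Node := fun n => List.replicate n ⟨0, hN⟩
  have hH : MeasurableSet ({τ : L.Labelling | ∀ v, τ v = τ (spine v.length)} ∩
      (fun τ n => τ (spine n)) ⁻¹' G) := by
    refine MeasurableSet.inter ?_ (measurableSet_preimage
      (measurable_pi_lambda _ fun n => measurable_pi_apply _) hGm)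
    rw [ofPred_forall]
    exact MeasurableSet.iInter fun v =>
      measurableSet_eq_fun (measurable_pi_apply _) (measurable_pi_apply _)
  have hmem : ∀ᵐ τ ∂L.homogeneousMeasure,
      τ ∈ {τ : L.Labelling | ∀ v, τ v = τ (spine v.length)} ∩ (fun τ n => τ (spine n)) ⁻¹' G := by
    have hf : Measurable fun (ω : ℕ → L.Λ) (v : L.Node) => ω v.length :=
      measurable_pi_lambda _ fun v => measurable_pi_apply v.length
    refine (ae_map_iff hf.aemeasurable hH).2 ?_
    filter_upwards [hG] with ω hω
    refine ⟨fun v => by simp [spine], ?_⟩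
    simpa [spine] using hω
  filter_upwards [hmem] with τ hτ
  have := hGp _ hτ.2
  rwa [← funext hτ.1] at this

end RIFS

theorem mainTheorem3 {k d : ℕ} (L : RIFS k d)
    (hne : L.NonExtinguishing) (hosc : L.UOSC) (hcon : L.ContractionCondition)
    (hzero : L.μ {l | (l : EuclideanSpace ℝ (Fin k)) = 0} = 0)
    (Δ : Set (EuclideanSpace ℝ (Fin d))) (hΔ : L.IsAdmissible Δ) :
    ∀ᵐ τ ∂L.homogeneousMeasure,
      IsQuasiAssouadDim (RIFS.attractor Δ τ) (dimH (RIFS.attractor Δ τ)) := by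
  have := L.isProbabilityMeasure_μ
  obtain ⟨cmin, cmax, h0, h01, h1, hc⟩ := hcon
  obtain ⟨O, hO, hOne, hOS, hdisj⟩ := hosc
  obtain ⟨hΔc, hΔne, hΔS⟩ := hΔ
  obtain ⟨s, hs, hs0⟩ := RIFS.exists_integral_log_total_eq_zero h0 h01 h1 hc hne hzero
  have hN : 0 < L.maxMaps := by
    obtain ⟨l, hl⟩ := (RIFS.ae_numMaps_ne_zero hzero).exists
    exact (Nat.pos_of_ne_zero hl).trans_le (L.numMaps_le l)
  have hnz : ∀ᵐ ω ∂(Measure.infinitePi fun _ : ℕ => L.μ), ∀ j, L.numMaps (ω j) ≠ 0 := by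
    rw [ae_all_iff]
    have hmp := measurePreserving_eval_infinitePi fun _ : ℕ => L.μ
    exact fun j => (hmp j).quasiMeasurePreserving.ae (RIFS.ae_numMaps_ne_zero hzero)
  refine RIFS.ae_homogeneousMeasure hN ?_
  filter_upwards [hnz, RIFS.ae_tendsto_sum_log_total
    (RIFS.integrable_log_total h0 h01 h1 hc hzero hs.le)] with ω hω hlim
  -- The choice of `s` makes the averages tend to `0`, which is the sublinear growth required below.
  rw [hs0] at hlim
  have := fun j => RIFS.nonempty_branch (hω j)
  rw [RIFS.attractor_homogeneous h0 h1 hc hω]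
  refine (RIFS.system h0 h1 hc ω).isQuasiAssouadDim_limitSet hΔc hΔne (fun j i => hΔS _ _ i.2)
    hO hOne (fun j i => hOS _ _ i.2) (fun j i i' h => Subtype.ext (hdisj _ _ _ i.2 i'.2 h)) hs
    fun ε hε => ?_
  have htot : ∀ j, (RIFS.system h0 h1 hc ω).total s j = L.total s (ω j) := fun j =>
    (L.total_eq_sum_branch s (ω j)).symm
  simp_rw [htot]
  exact exists_abs_le_mul_add_of_tendsto hlim hε
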